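/- Let $(M,g)$ be a compact connected smooth Riemannian manifold (without boundary) of dimension $n\ge 3$ whose Ricci tensor $\mathrm{Ric}$ is positive definite, so that $\mathrm{Ric}$ is itself a Riemannian metric on $M$. For a one-form $\theta$ put $\delta^*\theta=\tfrac12 L_{\theta^\#}g$, where $\theta^\#$ is the $g$-dual vector field, and call a smooth symmetric two-tensor $\varphi$ a TT-tensor if its divergence $\delta\varphi=-\sum_i(\nabla_{e_i}\varphi)(e_i,\cdot)$ and its trace $\mathrm{trace}_g\varphi$ vanish. A vector field $\xi$ is an infinitesimal harmonic transformation if $\mathrm{trace}_g(L_\xi\nabla)=0$, where $\nabla$ is the Levi-Civita connection of $g$ (that is, the flow of $\xi$ is harmonic to first order). For a smooth map $f:(M,g)\to(\bar M,\bar g)$ let $e(f)=\mathrm{trace}_g(f^*\bar g)$ be its energy density and $E(f)=\tfrac12\int_M e(f)\,dv_g$ its energy; let $s=\mathrm{trace}_g\mathrm{Ric}$ be the scalar curvature and $s(M)=\int_M s\,dv_g$ the total scalar curvature. Let $\mathrm{Ric}=(\delta^*\theta+\lambda g)+\varphi_{TT}$ be the York decomposition of $\mathrm{Ric}$, with $\theta$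 a smooth one-form, $\lambda$ a smooth function and $\varphi_{TT}$ a TT-tensor. Then the identity map $\mathrm{id}_M:(M,g)\to(M,\mathrm{Ric})$ is harmonic (its tension field vanishes). If moreover $\xi=\theta^\#$ is an infinitesimal harmonic transformation, then $\lambda$ is constant and $$\int_M e(\mathrm{id}_M)\,dv_g=s(M)=n\lambda\,\mathrm{Vol}(M,g),\qquad\text{i.e.}\qquad E(\mathrm{id}_M)=\tfrac12\,s(M)=\tfrac n2\,\lambda\,\mathrm{Vol}(M,g).$$ (Thus the energy equals the total scalar curvature if it is normalised without the factor $\tfrac12$.) -/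

import Mathlib

open MeasureTheory Bundle
open scoped Manifold ContDiff

noncomputable section

namespace RiemGeom

/-- Vector fields (not assumed smooth) on an `n`-manifold `M`. -/
abbrev VField (n : ℕ) (M : Type*) [TopologicalSpace M]
    [ChartedSpace (EuclideanSpace ℝ (Fin n)) M] :=
  Π x : M, TangentSpace (𝓡 n) x

/-- Fields of one-forms (not assumed smooth). -/
abbrev OneForm (n : ℕ) (M : Type*) [TopologicalSpace M]
    [ChartedSpace (EuclideanSpace ℝ (Fin n)) M] :=
  Π x : M, TangentSpace (𝓡 n) x →L[ℝ] ℝ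

/-- Fields of bilinear forms on the tangent spaces (not assumed smooth). -/
abbrev BilinForm (n : ℕ) (M : Type*) [TopologicalSpace M]
    [ChartedSpace (EuclideanSpace ℝ (Fin n)) M] :=
  Π x : M, TangentSpace (𝓡 n) x →L[ℝ] TangentSpace (𝓡 n) x →L[ℝ] ℝ

/-- The type of the values of a covariant two-tensor field, as functions of two tangent vectors.
All the constructions below are applied to fields that are bilinear at each point. -/
abbrev Tensor2 (n : ℕ) (M : Type*) [TopologicalSpace M]
    [ChartedSpace (EuclideanSpace ℝ (Fin n)) M] :=
  Π x : M, TangentSpace (𝓡 n) x → TangentSpace (𝓡 n) x → ℝ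

/-- Smooth Riemannian metrics on an `n`-manifold `M`. -/
abbrev Metric (n : ℕ) (M : Type*) [TopologicalSpace M]
    [ChartedSpace (EuclideanSpace ℝ (Fin n)) M] [IsManifold (𝓡 n) ∞ M] :=
  ContMDiffRiemannianMetric (𝓡 n) ∞ (EuclideanSpace ℝ (Fin n))
    (fun x : M => TangentSpace (𝓡 n) x)

section Defs

variable {n : ℕ} {M : Type*} [TopologicalSpace M] [ChartedSpace (EuclideanSpace ℝ (Fin n)) M]

/-- A field of bilinear forms, seen as a covariant two-tensor field. -/
def BilinForm.toTensor2 (φ : BilinForm n M) : Tensor2 n M := fun x v w => φ x v w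

/-! ### Metric algebra on a tangent space -/

/-- The vector `w` with `h x w v = α v` for all `v`
(unique, and existing for linear `α`, when `h x` is nondegenerate). -/
def dualVec (h : Tensor2 n M) (x : M) (α : TangentSpace (𝓡 n) x → ℝ) : TangentSpace (𝓡 n) x :=
  Classical.epsilon fun w => ∀ v, h x w v = α v

/-- The vector field `θ^#` dual to the one-form `θ`. -/
def sharp (g : Tensor2 n M) (θ : OneForm n M) : VField n M :=
  fun x => dualVec g x (θ x)

/-- `e` is a `g`-orthonormal basis of `T_x M`. -/
def IsOrthonormalFrame (g : Tensor2 n M) (x : M) (e : Fin n → TangentSpace (𝓡 n) x) : Prop :=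
  ∀ i j, g x (e i) (e j) = if i = j then 1 else 0

/-- A `g`-orthonormal basis of `T_x M`. -/
def orthoFrame (g : Tensor2 n M) (x : M) : Fin n → TangentSpace (𝓡 n) x :=
  Classical.epsilon (IsOrthonormalFrame g x)

/-- The trace `∑ i, B (e i) (e i)`, over a `g`-orthonormal basis of `T_x M`, of a bilinear map on
`T_x M` with values in any vector space; by bilinearity it does not depend on the basis. -/
def traceAt {V : Type*} [AddCommMonoid V] (g : Tensor2 n M) (x : M)
    (B : TangentSpace (𝓡 n) x → TangentSpace (𝓡 n) x → V) : V :=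
  ∑ i, B (orthoFrame g x i) (orthoFrame g x i)

/-! ### Differential operators

A tangent vector `v` at `x` is extended to a vector field `ext v` that is smooth near `x`; the
expressions below in which such extensions occur do not depend on the extension. -/

/-- A vector field, smooth near `x`, with value `v` at `x`. -/
def ext {x : M} [IsManifold (𝓡 n) 1 M] (v : TangentSpace (𝓡 n) x) : VField n M :=
  FiberBundle.extend (EuclideanSpace ℝ (Fin n)) (E := fun y : M => TangentSpace (𝓡 n) y) v

/-- The Lie bracket of vector fields. -/
def bracket (X Y : VField n M) : VField n M := VectorField.mlieBracket (𝓡 n) X Y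

/-- The derivative at `x` of the function `f` in the direction `v`. -/
def dirDeriv (f : M → ℝ) (x : M) (v : TangentSpace (𝓡 n) x) : ℝ := mvfderiv (𝓡 n) f x v

/-- The right-hand side of the Koszul formula for `h (∇_X Y, Z)`. -/
def koszul (h : Tensor2 n M) (X Y Z : VField n M) (x : M) : ℝ :=
  (1 / 2) * (dirDeriv (fun y => h y (Y y) (Z y)) x (X x)
    + dirDeriv (fun y => h y (X y) (Z y)) x (Y x)
    - dirDeriv (fun y => h y (X y) (Y y)) x (Z x)
    + h x (bracket X Y x) (Z x) - h x (bracket X Z x) (Y x) - h x (bracket Y Z x) (X x))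

variable [IsManifold (𝓡 n) 1 M]

/-- The Levi-Civita connection `∇_X Y` of the (pseudo-)Riemannian metric `h`, determined by the
Koszul formula. -/
def leviCivita (h : Tensor2 n M) (X Y : VField n M) : VField n M :=
  fun x => dualVec h x fun v => koszul h X Y (ext v) x

/-- The curvature `R(X,Y)Z = ∇_X ∇_Y Z - ∇_Y ∇_X Z - ∇_{[X,Y]} Z`. -/
def curvature (g : Tensor2 n M) (X Y Z : VField n M) : VField n M :=
  leviCivita g X (leviCivita g Y Z) - leviCivita g Y (leviCivita g X Z)
    - leviCivita g (bracket X Y) Z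

/-- The Ricci tensor `Ric(v,w) = trace (u ↦ R(u,v)w)`. -/
def ricci (g : Tensor2 n M) : Tensor2 n M := fun x v w =>
  traceAt g x fun u u' => g x (curvature g (ext u) (ext v) (ext w) x) u'

/-- The scalar curvature `trace_g Ric`. -/
def scalarCurvature (g : Tensor2 n M) (x : M) : ℝ := traceAt g x (ricci g x)

/-- The Lie derivative `L_ξ h` of a covariant two-tensor field. -/
def lieDeriv (ξ : VField n M) (h : Tensor2 n M) : Tensor2 n M := fun x v w =>
  dirDeriv (fun y => h y (ext v y) (ext w y)) x (ξ x)
    - h x (bracket ξ (ext v) x) w - h x v (bracket ξ (ext w) x)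

/-- The operator `δ^* θ = (1/2) L_{θ^#} g` on one-forms. -/
def deltaStar (g : Tensor2 n M) (θ : OneForm n M) : Tensor2 n M := fun x v w =>
  (1 / 2) * lieDeriv (sharp g θ) g x v w

/-- The covariant derivative `(∇_z φ)(v,w)` of a covariant two-tensor field. -/
def covDeriv (g φ : Tensor2 n M) (x : M) (z v w : TangentSpace (𝓡 n) x) : ℝ :=
  dirDeriv (fun y => φ y (ext v y) (ext w y)) x z
    - φ x (leviCivita g (ext z) (ext v) x) w - φ x v (leviCivita g (ext z) (ext w) x)

/-- The divergence `(δφ)(v) = - ∑ i, (∇_{e i} φ)(e i, v)` of a covariant two-tensor field. -/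
def divergence (g φ : Tensor2 n M) (x : M) (v : TangentSpace (𝓡 n) x) : ℝ :=
  - traceAt g x fun u u' => covDeriv g φ x u u' v

/-- The Lie derivative of the Levi-Civita connection,
`(L_ξ ∇)(X,Y) = [ξ, ∇_X Y] - ∇_{[ξ,X]} Y - ∇_X [ξ,Y]`, which is tensorial in `X` and `Y`. -/
def lieDerivConnection (g : Tensor2 n M) (ξ : VField n M) (x : M)
    (v w : TangentSpace (𝓡 n) x) : TangentSpace (𝓡 n) x :=
  bracket ξ (leviCivita g (ext v) (ext w)) x
    - leviCivita g (bracket ξ (ext v)) (ext w) x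
    - leviCivita g (ext v) (bracket ξ (ext w)) x

/-- `ξ` is an infinitesimal harmonic transformation: `trace_g (L_ξ ∇) = 0`. The left-hand side is
the derivative at `t = 0` of `trace_g (φ_t^* ∇ - ∇)`, the tension field of the flow `φ_t` of `ξ`
pulled back by `φ_t`, so this says that the flow is harmonic to first order. -/
def IsInfinitesimalHarmonic (g : Tensor2 n M) (ξ : VField n M) : Prop :=
  ∀ x, traceAt g x (lieDerivConnection g ξ x) = 0

/-! ### Smooth tensor fields and TT-tensors -/

/-- Smooth one-forms. -/
def IsSmoothOneForm (θ : OneForm n M) : Prop :=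
  ContMDiff (𝓡 n) ((𝓡 n).prod 𝓘(ℝ, EuclideanSpace ℝ (Fin n) →L[ℝ] ℝ)) ∞
    fun x => TotalSpace.mk' (EuclideanSpace ℝ (Fin n) →L[ℝ] ℝ)
      (E := fun x : M => TangentSpace (𝓡 n) x →L[ℝ] Trivial M ℝ x) x (θ x)

/-- Smooth fields of bilinear forms. -/
def IsSmoothBilinForm (φ : BilinForm n M) : Prop :=
  ContMDiff (𝓡 n) ((𝓡 n).prod 𝓘(ℝ, EuclideanSpace ℝ (Fin n) →L[ℝ]
      EuclideanSpace ℝ (Fin n) →L[ℝ] ℝ)) ∞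
    fun x => TotalSpace.mk'
      (EuclideanSpace ℝ (Fin n) →L[ℝ] EuclideanSpace ℝ (Fin n) →L[ℝ] ℝ)
      (E := fun x : M => TangentSpace (𝓡 n) x →L[ℝ] TangentSpace (𝓡 n) x →L[ℝ] Trivial M ℝ x)
      x (φ x)

/-- `φ` is a TT-tensor: a smooth symmetric covariant two-tensor field that is
divergence free and trace free with respect to `g`. -/
structure IsTT (g : Tensor2 n M) (φ : BilinForm n M) : Prop where
  smooth : IsSmoothBilinForm φ
  symm : ∀ x v w, φ x v w = φ x w v
  divergence_eq_zero : ∀ x v, divergence g φ.toTensor2 x v = 0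
  trace_eq_zero : ∀ x, traceAt g x (φ.toTensor2 x) = 0

/-! ### Harmonicity of the identity map -/

/-- The second fundamental form `(Df_*)(X,Y) = ∇'_X f_* Y - f_* ∇_X Y` of the identity map
`(M,g) → (M,h)`. -/
def secondFundamentalFormId (g h : Tensor2 n M) (x : M) (v w : TangentSpace (𝓡 n) x) :
    TangentSpace (𝓡 n) x :=
  leviCivita h (ext v) (ext w) x - leviCivita g (ext v) (ext w) x

/-- The identity map `(M,g) → (M,h)` is harmonic: its tension field `trace_g (D id_*)` vanishes. -/
def IsHarmonicId (g h : Tensor2 n M) : Prop :=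
  ∀ x, traceAt g x (secondFundamentalFormId g h x) = 0

end Defs

/-! ### Riemannian volume, energy, total scalar curvature -/

section Volume

variable {n : ℕ} {M : Type*} [TopologicalSpace M] [ChartedSpace (EuclideanSpace ℝ (Fin n)) M]

/-- The coordinate vector field `∂_i` of the chart at `c`, at the point with coordinates `y`. -/
def coordVec (c : M) (y : EuclideanSpace ℝ (Fin n)) (i : Fin n) :
    TangentSpace (𝓡 n) ((extChartAt (𝓡 n) c).symm y) :=
  mfderiv 𝓘(ℝ, EuclideanSpace ℝ (Fin n)) (𝓡 n) (extChartAt (𝓡 n) c).symm y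
    (EuclideanSpace.single i (1 : ℝ) : EuclideanSpace ℝ (Fin n))

/-- The density `√(det (g (∂_i, ∂_j)))` in the chart at `c`. -/
def volDensity (g : Tensor2 n M) (c : M) (y : EuclideanSpace ℝ (Fin n)) : ℝ :=
  √(Matrix.det (Matrix.of fun i j : Fin n =>
    g ((extChartAt (𝓡 n) c).symm y) (coordVec c y i) (coordVec c y j)))

variable [MeasurableSpace M]

/-- The measure `√(det g) dy` of the chart at `c`, carried over to `M`. -/
def chartVolume (g : Tensor2 n M) (c : M) : Measure M :=
  Measure.map (extChartAt (𝓡 n) c).symm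
    ((volume.restrict (extChartAt (𝓡 n) c).target).withDensity
      fun y => ENNReal.ofReal (volDensity g c y))

variable [IsManifold (𝓡 n) ∞ M] [T2Space M] [SigmaCompactSpace M]

variable (n M) in
/-- A smooth partition of unity subordinate to the chart domains. -/
def chartPartition : SmoothPartitionOfUnity M (𝓡 n) M Set.univ :=
  (SmoothPartitionOfUnity.exists_isSubordinate_chartAt_source (𝓡 n) M).choose

/-- The Riemannian volume measure, patched together from the measures `√(det g) dy` of the charts
by a partition of unity (on which it does not depend). -/
def volumeMeasure (g : Tensor2 n M) : Measure M :=
  Measure.sum fun c : M =>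
    (chartVolume g c).withDensity fun x => ENNReal.ofReal (chartPartition n M c x)

/-- The volume of `(M,g)`. -/
def vol (g : Tensor2 n M) : ℝ := (volumeMeasure g).real Set.univ

/-- The total scalar curvature `∫ s dv_g`. -/
def totalScalarCurvature (g : Tensor2 n M) : ℝ :=
  ∫ x, scalarCurvature g x ∂(volumeMeasure g)

end Volume

section Energy

variable {n m : ℕ} {M : Type*} [TopologicalSpace M] [ChartedSpace (EuclideanSpace ℝ (Fin n)) M]
  {N : Type*} [TopologicalSpace N] [ChartedSpace (EuclideanSpace ℝ (Fin m)) N]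

/-- The pullback `f^* h` of a covariant two-tensor field under a map `f : M → N`. -/
def pullback (f : M → N) (h : Tensor2 m N) : Tensor2 n M := fun x v w =>
  h (f x) (mfderiv (𝓡 n) (𝓡 m) f x v) (mfderiv (𝓡 n) (𝓡 m) f x w)

/-- The energy density `e(f) = trace_g (f^* h)` of a map `f : (M,g) → (N,h)`. -/
def energyDensity (g : Tensor2 n M) (h : Tensor2 m N) (f : M → N) (x : M) : ℝ :=
  traceAt g x (pullback f h x)

/-- The energy `E(f) = (1/2) ∫ e(f) dv_g` of a map `f : (M,g) → (N,h)`. -/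
def energy [MeasurableSpace M] [IsManifold (𝓡 n) ∞ M] [T2Space M] [SigmaCompactSpace M]
    (g : Tensor2 n M) (h : Tensor2 m N) (f : M → N) : ℝ :=
  (1 / 2) * ∫ x, energyDensity g h f x ∂(volumeMeasure g)

end Energy

/-- The metric `g`, seen as a covariant two-tensor field. -/
def Metric.tensor {n : ℕ} {M : Type*} [TopologicalSpace M]
    [ChartedSpace (EuclideanSpace ℝ (Fin n)) M] [IsManifold (𝓡 n) ∞ M]
    (g : Metric n M) : Tensor2 n M := fun x v w => g.inner x v w

end RiemGeom

end

/-! Both conclusions come from one first-order operator on symmetric two-tensors, β(h) = div h − ½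
d(tr_g h), where div h = ∑ (∇_{e_i} h)(e_i, ·) = −δh.

For a second metric h, the Koszul formula gives h(∇'_v w − ∇_v w, z) = ½((∇_v h)(w,z) + (∇_w h)(v,z)
− (∇_z h)(v,w)), so tracing over a g-orthonormal frame shows that the tension field τ of the
identity satisfies h(τ, ·) = β(h) (`LocalMetric.tension`). The contracted second Bianchi identity
says exactly β(Ric) = 0 (`LocalMetric.contracted_bianchi`). Hence the identity into (M, Ric) is
harmonic.

The Lie derivative of the Levi-Civita connection obeys the same formula with L_ξ g in place of h
(`LocalMetric.lieConn_eq`), so g(trace_g L_ξ∇, ·) = β(L_ξ g), and ξ is infinitesimally harmonic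
exactly when β(L_ξ g) = 0. Apply β to the York decomposition: Ric, ½ L_ξ g and the TT part
contribute nothing, while β(λg) = (1 − n/2) dλ. Since n ≥ 3, dλ = 0, and connectedness makes λ
constant (`LocalMetric.fderiv_eq_zero_of_york`, `IsYork.exists_eq_const`).

The energy density of the identity is tr_g Ric = s, so the energy identity is immediate. Tracing the
York decomposition gives s = div ξ + nλ, and the divergence theorem removes div ξ on integration
(`integral_traceAt_deltaStar`). That theorem is proved by writing ξ = ∑ χ_c ξ with the partition of
unity that defines the volume measure. In each chart, Jacobi's formula turns √(det g) · div(χ_c ξ)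
into a Euclidean divergence with compact support. The change of variables formula shows that the
glued measure agrees with √(det g) dy on every chart domain (`volumeMeasure_restrict_source`).

The differential identities are proved on an open subset of a vector space, for a metric `G` with
values in bilinear forms and its Christoffel symbols. They are transferred to M through coordinate
expressions of vector fields (`Represents`) and two-tensors (`TensorRep`). These expressions also
show that the arbitrary choices in the definitions (dual vectors, frames, extensions of tangent
vectors) are harmless. -/

set_option maxSynthPendingDepth 3

/-! ### Linear algebra: inner products and orthonormal frames -/

namespace LocalGeom

open Module Filter Topology

variable {E : Type*} [NormedAddCommGroup E] [NormedSpace ℝ E]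

/-- Continuous bilinear forms on `E`. -/
abbrev Bil (E : Type*) [NormedAddCommGroup E] [NormedSpace ℝ E] := E →L[ℝ] E →L[ℝ] ℝ

/-- A symmetric positive definite bilinear form. -/
structure IsInner (B : Bil E) : Prop where
  symm : ∀ v w, B v w = B w v
  pos : ∀ v, v ≠ 0 → 0 < B v v

/-- `e` is an orthonormal family for `B`. -/
def IsFrame {n : ℕ} (B : Bil E) (e : Fin n → E) : Prop :=
  ∀ i j, B (e i) (e j) = if i = j then 1 else 0

theorem IsInner.eq_of_forall {B : Bil E} (hB : IsInner B) {v w : E} (h : ∀ z, B v z = B w z) :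
    v = w := by
  by_contra hne
  have h1 := hB.pos (v - w) (sub_ne_zero.2 hne)
  have h2 : B (v - w) (v - w) = 0 := by
    simp only [B.map_sub, sub_apply, h, sub_self]
  exact h1.ne' h2

variable [FiniteDimensional ℝ E]

/-- Definiteness gives injectivity, and E and its dual have the same dimension. This makes
`B.inverse` a genuine inverse rather than the default value 0. -/
theorem IsInner.exists_equiv {B : Bil E} (hB : IsInner B) :
    ∃ e : E ≃L[ℝ] (E →L[ℝ] ℝ), (e : E →L[ℝ] (E →L[ℝ] ℝ)) = B := by
  have hinj : Function.Injective (B : E →ₗ[ℝ] (E →L[ℝ] ℝ)) := fun v w h =>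
    hB.eq_of_forall fun z => by
      have : B v = B w := h
      rw [this]
  have hfin : finrank ℝ E = finrank ℝ (E →L[ℝ] ℝ) := by
    rw [← (LinearMap.toContinuousLinearMap (𝕜 := ℝ) (E := E) (F' := ℝ)).finrank_eq]
    exact (Subspace.dual_finrank_eq (K := ℝ) (V := E)).symm
  refine ⟨(LinearEquiv.ofInjectiveOfFinrankEq (B : E →ₗ[ℝ] (E →L[ℝ] ℝ)) hinj
    hfin).toContinuousLinearEquiv, ?_⟩
  ext v w
  rfl

theorem IsInner.inverse_apply {B : Bil E} (hB : IsInner B) (α : E →L[ℝ] ℝ) (v : E) :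
    B (B.inverse α) v = α v := by
  obtain ⟨e, rfl⟩ := hB.exists_equiv
  simp

theorem IsInner.exists_frame {n : ℕ} (hn : finrank ℝ E = n) {B : Bil E} (hB : IsInner B) :
    ∃ e : Fin n → E, IsFrame B e := by
  subst hn
  let B' : LinearMap.BilinForm ℝ E := LinearMap.mk₂ ℝ (fun v w => B v w) (by simp) (by simp)
    (by simp) (by simp)
  have hs : LinearMap.IsSymm B' := ⟨fun v w => hB.symm v w⟩
  obtain ⟨b, hb⟩ := LinearMap.BilinForm.exists_orthogonal_basis hs
  refine ⟨fun i => (√(B (b i) (b i)))⁻¹ • b i, fun i j => ?_⟩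
  have hpos : ∀ i, 0 < B (b i) (b i) := fun i => hB.pos _ (b.ne_zero i)
  simp only [map_smul, smul_apply, smul_eq_mul]
  split_ifs with hij
  · subst hij
    have := Real.mul_self_sqrt (hpos i).le
    have h2 := (Real.sqrt_pos.2 (hpos i)).ne'
    field_simp
    rw [sq]; exact this.symm
  · have : B (b i) (b j) = 0 := hb hij
    simp [this]

section Frame

variable {n : ℕ} {B : Bil E} {e : Fin n → E}

omit [FiniteDimensional ℝ E] in
theorem IsFrame.linearIndependent (he : IsFrame B e) : LinearIndependent ℝ e := by
  rw [Fintype.linearIndependent_iff]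
  intro c hc i
  have : B (∑ j, c j • e j) (e i) = 0 := by simp [hc]
  simpa [map_sum, sum_apply, he _ _] using this

/-- An orthonormal family of the right size, as a basis. -/
noncomputable def IsFrame.basis (he : IsFrame B e) (hn : finrank ℝ E = n) :
    Basis (Fin n) ℝ E :=
  haveI : Nontrivial E ∨ n = 0 := by
    rcases Nat.eq_zero_or_pos n with h | h
    · exact Or.inr h
    · exact Or.inl (nontrivial_of_finrank_pos (R := ℝ) (by omega))
  Basis.mk he.linearIndependent (by
    rw [he.linearIndependent.span_eq_top_of_card_eq_finrank' (by simp [hn])])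

theorem IsFrame.basis_apply (he : IsFrame B e) (hn : finrank ℝ E = n) (i : Fin n) :
    he.basis hn i = e i := by
  simp [IsFrame.basis]

theorem IsFrame.sum_smul (he : IsFrame B e) (hn : finrank ℝ E = n) (v : E) :
    ∑ i, B v (e i) • e i = v := by
  have hr := (he.basis hn).sum_repr v
  have key : ∀ i, B v (e i) = (he.basis hn).repr v i := by
    intro i
    conv_lhs => rw [← hr]
    simp [map_sum, sum_apply, he.basis_apply, he _ _]
  conv_rhs => rw [← hr]
  exact Finset.sum_congr rfl fun i _ => by rw [key, he.basis_apply]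

theorem IsFrame.repr (he : IsFrame B e) (hn : finrank ℝ E = n) (v : E) (i : Fin n) :
    (he.basis hn).repr v i = B v (e i) := by
  conv_lhs => rw [← he.sum_smul hn v]
  simp only [map_sum, map_smul, ← he.basis_apply hn]
  simp [Finsupp.single_apply]

theorem IsFrame.trace_eq (he : IsFrame B e) (hn : finrank ℝ E = n) (T : E →L[ℝ] E) :
    LinearMap.trace ℝ E (T : E →ₗ[ℝ] E) = ∑ i, B (T (e i)) (e i) := by
  rw [LinearMap.trace_eq_matrix_trace ℝ (he.basis hn), Matrix.trace]
  refine Finset.sum_congr rfl fun i _ => ?_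
  rw [Matrix.diag_apply, LinearMap.toMatrix_apply, he.repr, he.basis_apply]
  rfl

/-- Expansion of the first argument of a bilinear map in a frame. -/
theorem IsFrame.sum_left (he : IsFrame B e) (hn : finrank ℝ E = n) {F : Type*}
    [AddCommGroup F] [Module ℝ F] (β : E →ₗ[ℝ] F) (v : E) :
    ∑ j, B v (e j) • β (e j) = β v := by
  conv_rhs => rw [← he.sum_smul hn v]
  simp

end Frame

end LocalGeom

/-! ### Christoffel symbols, curvature and the second Bianchi identity on an open set -/

namespace LocalGeom

open Module Filter Topology

variable {E : Type*} [NormedAddCommGroup E] [NormedSpace ℝ E]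

section Calculus

variable {F : Type*} [NormedAddCommGroup F] [NormedSpace ℝ F]

theorem fderiv_apply₁ {H : E → E →L[ℝ] F} {V : E → E} {y : E} (hH : DifferentiableAt ℝ H y)
    (hV : DifferentiableAt ℝ V y) (a : E) :
    fderiv ℝ (fun z => H z (V z)) y a = fderiv ℝ H y a (V y) + H y (fderiv ℝ V y a) := by
  rw [fderiv_clm_apply hH hV]
  simp [add_comm]

theorem fderiv_apply₂ {H : E → E →L[ℝ] E →L[ℝ] F} {V W : E → E} {y : E}
    (hH : DifferentiableAt ℝ H y) (hV : DifferentiableAt ℝ V y) (hW : DifferentiableAt ℝ W y)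
    (a : E) :
    fderiv ℝ (fun z => H z (V z) (W z)) y a =
      fderiv ℝ H y a (V y) (W y) + H y (fderiv ℝ V y a) (W y) + H y (V y) (fderiv ℝ W y a) := by
  rw [fderiv_apply₁ (hH.clm_apply hV) hW, fderiv_apply₁ hH hV]
  simp

theorem fderiv_const₁ {H : E → E →L[ℝ] F} {y : E} (hH : DifferentiableAt ℝ H y) (a b : E) :
    fderiv ℝ (fun z => H z b) y a = fderiv ℝ H y a b := by
  rw [fderiv_apply₁ hH (differentiableAt_const b)]
  simp

theorem fderiv_const₂ {H : E → E →L[ℝ] E →L[ℝ] F} {y : E} (hH : DifferentiableAt ℝ H y)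
    (a b c : E) : fderiv ℝ (fun z => H z b c) y a = fderiv ℝ H y a b c := by
  rw [fderiv_const₁ (hH.clm_apply (differentiableAt_const b)), fderiv_const₁ hH]

theorem fderiv_const₃ {H : E → E →L[ℝ] E →L[ℝ] E →L[ℝ] F} {y : E} (hH : DifferentiableAt ℝ H y)
    (a b c d : E) : fderiv ℝ (fun z => H z b c d) y a = fderiv ℝ H y a b c d := by
  rw [fderiv_const₁ ((hH.clm_apply (differentiableAt_const b)).clm_apply
    (differentiableAt_const c)), fderiv_const₂ hH]

theorem fderiv_fderiv_symm {H : E → F} {y : E} (hH : ContDiffAt ℝ ∞ H y) (a b : E) :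
    fderiv ℝ (fderiv ℝ H) y a b = fderiv ℝ (fderiv ℝ H) y b a := by
  have := hH.isSymmSndFDerivAt (by
    simp only [minSmoothness_of_isRCLikeNormedField]; exact ENat.LEInfty.out)
  exact this a b

theorem contDiffAt_fderiv {H : E → F} {y : E} (hH : ContDiffAt ℝ ∞ H y) :
    ContDiffAt ℝ ∞ (fderiv ℝ H) y :=
  hH.fderiv_right (by simp)

end Calculus

/-- The bilinear map `(a, b) ↦ ½ (D a b · + D b a · - D · a b)` of the Koszul formula. -/
noncomputable def koszulForm (D : E →L[ℝ] Bil E) : E →L[ℝ] E →L[ℝ] E →L[ℝ] ℝ :=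
  (1 / 2 : ℝ) • (D + D.flip -
    ((ContinuousLinearMap.flipₗᵢ ℝ E E ℝ).toContinuousLinearEquiv :
      (Bil E) →L[ℝ] (Bil E)).comp D.flip)

@[simp] theorem koszulForm_apply (D : E →L[ℝ] Bil E) (a b c : E) :
    koszulForm D a b c = (1 / 2) * (D a b c + D b a c - D c a b) := by
  simp [koszulForm]

/-- The Christoffel symbols of the metric `G`. -/
noncomputable def christoffel (G : E → Bil E) (y : E) : E →L[ℝ] E →L[ℝ] E :=
  (ContinuousLinearMap.compL ℝ E (E →L[ℝ] ℝ) E (G y).inverse).comp (koszulForm (fderiv ℝ G y))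

/-- `G` is a smooth Riemannian metric on the open set `Ω`. -/
structure LocalMetric (Ω : Set E) (G : E → Bil E) : Prop where
  isOpen : IsOpen Ω
  smooth : ContDiffOn ℝ ∞ G Ω
  inner : ∀ y ∈ Ω, IsInner (G y)

variable [FiniteDimensional ℝ E] {Ω : Set E} {G : E → Bil E}

omit [FiniteDimensional ℝ E] in
theorem LocalMetric.contDiffAt (hG : LocalMetric Ω G) {y : E} (hy : y ∈ Ω) : ContDiffAt ℝ ∞ G y :=
  hG.smooth.contDiffAt (hG.isOpen.mem_nhds hy)

omit [FiniteDimensional ℝ E] in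
theorem LocalMetric.differentiableAt (hG : LocalMetric Ω G) {y : E} (hy : y ∈ Ω) :
    DifferentiableAt ℝ G y := (hG.contDiffAt hy).differentiableAt (by simp)

/-- Inversion of continuous linear maps is smooth at every equivalence, and each `G y` is one. The
smoothness of all later objects built from the metric rests on this. -/
theorem LocalMetric.contDiffOn_inverse (hG : LocalMetric Ω G) :
    ContDiffOn ℝ ∞ (fun y => (G y).inverse) Ω := by
  intro y hy
  obtain ⟨e, he⟩ := (hG.inner y hy).exists_equiv
  have h := contDiffAt_map_inverse (n := ∞) e
  rw [he] at h
  exact (h.comp y (hG.contDiffAt hy)).contDiffWithinAt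

theorem LocalMetric.christoffel_spec (hG : LocalMetric Ω G) {y : E} (hy : y ∈ Ω) (a b c : E) :
    G y (christoffel G y a b) c =
      (1 / 2) * (fderiv ℝ G y a b c + fderiv ℝ G y b a c - fderiv ℝ G y c a b) := by
  rw [← koszulForm_apply]
  exact (hG.inner y hy).inverse_apply _ _

theorem LocalMetric.contDiffOn_christoffel (hG : LocalMetric Ω G) :
    ContDiffOn ℝ ∞ (christoffel G) Ω := by
  have h1 : ContDiffOn ℝ ∞ (fderiv ℝ G) Ω := fun y hy =>
    (contDiffAt_fderiv (hG.contDiffAt hy)).contDiffWithinAt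
  refine contDiffOn_clm_apply.2 fun a => contDiffOn_clm_apply.2 fun b => ?_
  change ContDiffOn ℝ ∞ (fun y => (G y).inverse (koszulForm (fderiv ℝ G y) a b)) Ω
  refine hG.contDiffOn_inverse.clm_apply ?_
  rw [contDiffOn_clm_apply]
  intro c
  simp only [koszulForm_apply]
  fun_prop

theorem LocalMetric.contDiffAt_christoffel (hG : LocalMetric Ω G) {y : E} (hy : y ∈ Ω) :
    ContDiffAt ℝ ∞ (christoffel G) y :=
  hG.contDiffOn_christoffel.contDiffAt (hG.isOpen.mem_nhds hy)

theorem LocalMetric.differentiableAt_christoffel (hG : LocalMetric Ω G) {y : E} (hy : y ∈ Ω) :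
    DifferentiableAt ℝ (christoffel G) y :=
  (hG.contDiffAt_christoffel hy).differentiableAt (by simp)

omit [FiniteDimensional ℝ E] in
/-- Derivatives inherit the symmetry of a field of bilinear forms. -/
theorem fderiv_symm (hΩ : IsOpen Ω) (hs : ∀ y ∈ Ω, ∀ v w, G y v w = G y w v) {y : E} (hy : y ∈ Ω)
    (hG : DifferentiableAt ℝ G y) (a b c : E) : fderiv ℝ G y a b c = fderiv ℝ G y a c b := by
  rw [← fderiv_const₂ hG, ← fderiv_const₂ hG]
  congr 1
  refine Filter.EventuallyEq.fderiv_eq ?_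
  filter_upwards [hΩ.mem_nhds hy] with z hz using hs z hz b c

omit [FiniteDimensional ℝ E] in
theorem LocalMetric.fderiv_symm (hG : LocalMetric Ω G) {y : E} (hy : y ∈ Ω) (a b c : E) :
    fderiv ℝ G y a b c = fderiv ℝ G y a c b :=
  LocalGeom.fderiv_symm hG.isOpen (fun z hz => (hG.inner z hz).symm) hy (hG.differentiableAt hy)
    a b c

theorem LocalMetric.christoffel_symm (hG : LocalMetric Ω G) {y : E} (hy : y ∈ Ω) (a b : E) :
    christoffel G y a b = christoffel G y b a := by
  refine (hG.inner y hy).eq_of_forall fun c => ?_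
  rw [hG.christoffel_spec hy, hG.christoffel_spec hy, hG.fderiv_symm hy c a b]
  ring

/-- The Levi-Civita connection is metric. -/
theorem LocalMetric.fderiv_eq (hG : LocalMetric Ω G) {y : E} (hy : y ∈ Ω) (a b c : E) :
    fderiv ℝ G y a b c = G y (christoffel G y a b) c + G y b (christoffel G y a c) := by
  rw [(hG.inner y hy).symm b, hG.christoffel_spec hy, hG.christoffel_spec hy,
    hG.fderiv_symm hy a c b, hG.fderiv_symm hy b a c, hG.fderiv_symm hy c a b]
  ring

/-- The covariant derivative `(∇_a β)(b, c)` of a field of bilinear forms. -/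
noncomputable def nablaBil (G β : E → Bil E) (y a b c : E) : ℝ :=
  fderiv ℝ β y a b c - β y (christoffel G y a b) c - β y b (christoffel G y a c)

/-- The curvature `R(a, b) c` of the metric `G`. -/
noncomputable def curv (G : E → Bil E) (y : E) : E →L[ℝ] E →L[ℝ] E →L[ℝ] E :=
  let D := fderiv ℝ (christoffel G) y
  let C := (ContinuousLinearMap.compL ℝ E E E).bilinearComp (christoffel G y) (christoffel G y)
  D - D.flip + C - C.flip

omit [FiniteDimensional ℝ E] in
theorem curv_apply (G : E → Bil E) (y a b c : E) : curv G y a b c =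
    fderiv ℝ (christoffel G) y a b c - fderiv ℝ (christoffel G) y b a c
      + christoffel G y a (christoffel G y b c) - christoffel G y b (christoffel G y a c) := by
  simp [curv]

omit [FiniteDimensional ℝ E] in
theorem curv_swap (G : E → Bil E) (y a b c : E) : curv G y a b c = -curv G y b a c := by
  simp only [curv_apply]; abel

theorem LocalMetric.contDiffOn_curv (hG : LocalMetric Ω G) : ContDiffOn ℝ ∞ (curv G) Ω := by
  have h0 := hG.contDiffOn_christoffel
  have h1 : ContDiffOn ℝ ∞ (fderiv ℝ (christoffel G)) Ω := fun y hy =>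
    (contDiffAt_fderiv (hG.contDiffAt_christoffel hy)).contDiffWithinAt
  simp only [contDiffOn_clm_apply, curv_apply]
  intro a b c
  fun_prop

theorem LocalMetric.differentiableAt_curv (hG : LocalMetric Ω G) {y : E} (hy : y ∈ Ω) :
    DifferentiableAt ℝ (curv G) y :=
  (hG.contDiffOn_curv.contDiffAt (hG.isOpen.mem_nhds hy)).differentiableAt (by simp)

/-- The covariant derivative `(∇_a R)(b, c) d` of the curvature. -/
noncomputable def nablaCurv (G : E → Bil E) (y a b c d : E) : E :=
  fderiv ℝ (curv G) y a b c d + christoffel G y a (curv G y b c d)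
    - curv G y (christoffel G y a b) c d - curv G y b (christoffel G y a c) d
    - curv G y b c (christoffel G y a d)

theorem LocalMetric.fderiv_curv (hG : LocalMetric Ω G) {y : E} (hy : y ∈ Ω) (a b c d : E) :
    fderiv ℝ (curv G) y a b c d =
      fderiv ℝ (fderiv ℝ (christoffel G)) y a b c d - fderiv ℝ (fderiv ℝ (christoffel G)) y a c b d
      + (fderiv ℝ (christoffel G) y a b (christoffel G y c d)
        + christoffel G y b (fderiv ℝ (christoffel G) y a c d))
      - (fderiv ℝ (christoffel G) y a c (christoffel G y b d)
        + christoffel G y c (fderiv ℝ (christoffel G) y a b d)) := by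
  have hΓ := hG.contDiffAt_christoffel hy
  have d0 := hG.differentiableAt_christoffel hy
  have d1 : DifferentiableAt ℝ (fderiv ℝ (christoffel G)) y :=
    (contDiffAt_fderiv hΓ).differentiableAt (by simp)
  have e1 : ∀ b c : E, fderiv ℝ (fun z => christoffel G z b (christoffel G z c d)) y a =
      fderiv ℝ (christoffel G) y a b (christoffel G y c d)
        + christoffel G y b (fderiv ℝ (christoffel G) y a c d) := fun b c => by
    rw [fderiv_apply₂ d0 (differentiableAt_const b) (by fun_prop), fderiv_const₂ d0]
    simp
  rw [← fderiv_const₃ (hG.differentiableAt_curv hy)]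
  simp only [curv_apply]
  rw [fderiv_fun_sub (by fun_prop) (by fun_prop), fderiv_fun_add (by fun_prop) (by fun_prop),
    fderiv_fun_sub (by fun_prop) (by fun_prop)]
  simp only [add_apply, sub_apply, e1, fderiv_const₃ d1]

/-- The second Bianchi identity. -/
theorem LocalMetric.bianchi (hG : LocalMetric Ω G) {y : E} (hy : y ∈ Ω) (a b c d : E) :
    nablaCurv G y a b c d + nablaCurv G y b c a d + nablaCurv G y c a b d = 0 := by
  have hs := fderiv_fderiv_symm (hG.contDiffAt_christoffel hy)
  -- Torsion-freeness matches each term with Γ in a curvature slot to the opposite term of a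
  -- cyclically permuted summand. The rest cancels by symmetry of the second derivatives of Γ.
  have h1 : curv G y (christoffel G y a b) c d = - curv G y c (christoffel G y b a) d := by
    rw [hG.christoffel_symm hy b a, curv_swap]
  have h2 : curv G y b (christoffel G y a c) d = - curv G y (christoffel G y c a) b d := by
    rw [hG.christoffel_symm hy c a, curv_swap]
  have h3 : curv G y (christoffel G y b c) a d = - curv G y a (christoffel G y c b) d := by
    rw [hG.christoffel_symm hy b c, curv_swap]
  simp only [nablaCurv, hG.fderiv_curv hy, h1, h2, h3]
  simp only [curv_apply, hs b a, hs c a, hs c b, map_add, map_sub]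
  abel

/-- Differentiate metric compatibility once more: the second derivative of G is symmetric in its two
directions, and its antisymmetrisation is G(R(a,b)c, d) + G(c, R(a,b)d). -/
theorem LocalMetric.curv_skew (hG : LocalMetric Ω G) {y : E} (hy : y ∈ Ω) (a b c d : E) :
    G y (curv G y a b c) d = - G y c (curv G y a b d) := by
  have dG := hG.differentiableAt hy
  have dΓ := hG.differentiableAt_christoffel hy
  have d1 : DifferentiableAt ℝ (fderiv ℝ G) y :=
    (contDiffAt_fderiv (hG.contDiffAt hy)).differentiableAt (by simp)
  have key : ∀ a b : E, fderiv ℝ (fderiv ℝ G) y a b c d =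
      fderiv ℝ G y a (christoffel G y b c) d + G y (fderiv ℝ (christoffel G) y a b c) d
      + (fderiv ℝ G y a c (christoffel G y b d) + G y c (fderiv ℝ (christoffel G) y a b d)) := by
    intro a b
    rw [← fderiv_const₃ d1]
    have : (fun z => fderiv ℝ G z b c d) =ᶠ[𝓝 y] fun z =>
        G z (christoffel G z b c) d + G z c (christoffel G z b d) := by
      filter_upwards [hG.isOpen.mem_nhds hy] with z hz using hG.fderiv_eq hz b c d
    rw [this.fderiv_eq, fderiv_fun_add (by fun_prop) (by fun_prop)]
    simp only [add_apply]
    rw [fderiv_apply₂ dG (by fun_prop) (by fun_prop), fderiv_apply₂ dG (by fun_prop) (by fun_prop),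
      fderiv_const₂ dΓ, fderiv_const₂ dΓ]
    simp
  have h := fderiv_fderiv_symm (hG.contDiffAt hy) a b
  have h' : fderiv ℝ (fderiv ℝ G) y a b c d = fderiv ℝ (fderiv ℝ G) y b a c d := by rw [h]
  rw [key, key] at h'
  simp only [hG.fderiv_eq hy] at h'
  simp only [curv_apply, map_add, map_sub, add_apply, sub_apply]
  linarith

/-- This is the derivative of the identity `curv_skew`. The terms from dG are rewritten by metric
compatibility, and the Christoffel corrections are matched by applying `curv_skew` with one slot
changed at a time. -/
theorem LocalMetric.nablaCurv_skew (hG : LocalMetric Ω G) {y : E} (hy : y ∈ Ω) (a b c d e : E) :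
    G y (nablaCurv G y a b c d) e = - G y d (nablaCurv G y a b c e) := by
  have dG := hG.differentiableAt hy
  have dR := hG.differentiableAt_curv hy
  have h : fderiv ℝ (fun z => G z (curv G z b c d) e + G z d (curv G z b c e)) y a = 0 := by
    have : (fun z => G z (curv G z b c d) e + G z d (curv G z b c e)) =ᶠ[𝓝 y] fun _ => 0 := by
      filter_upwards [hG.isOpen.mem_nhds hy] with z hz
      rw [hG.curv_skew hz]; ring
    rw [this.fderiv_eq]; simp
  rw [fderiv_fun_add (by fun_prop) (by fun_prop)] at h
  simp only [add_apply] at h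
  rw [fderiv_apply₂ dG (by fun_prop) (by fun_prop), fderiv_apply₂ dG (by fun_prop) (by fun_prop),
      fderiv_const₃ dR, fderiv_const₃ dR] at h
  simp only [hG.fderiv_eq hy, fderiv_fun_const, Pi.zero_apply, zero_apply, map_zero] at h
  have hs := hG.curv_skew hy
  have s1 := hs (christoffel G y a b) c d e
  have s2 := hs b (christoffel G y a c) d e
  have s3 := hs b c (christoffel G y a d) e
  have s4 := hs b c d (christoffel G y a e)
  simp only [nablaCurv, map_add, map_sub, add_apply, sub_apply]
  linarith

end LocalGeom

/-! ### Metric traces, Ricci tensor, tension field, Lie derivative of the connection -/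

namespace LocalGeom

open Module Filter Topology

variable {E : Type*} [NormedAddCommGroup E] [NormedSpace ℝ E] [FiniteDimensional ℝ E]

variable (E) in
/-- The trace of endomorphisms of `E`, as a continuous linear form. -/
noncomputable def traceL : (E →L[ℝ] E) →L[ℝ] ℝ :=
  LinearMap.toContinuousLinearMap
    ((LinearMap.trace ℝ E).comp (ContinuousLinearMap.coeLM ℝ : (E →L[ℝ] E) →ₗ[ℝ] (E →ₗ[ℝ] E)))

/-- The vanishing trace of a commutator is what makes ∇ commute with contractions, with a frame
fixed at one point and never differentiated. -/
theorem traceL_comp_comm (S T : E →L[ℝ] E) : traceL E (S.comp T) = traceL E (T.comp S) :=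
  LinearMap.trace_mul_comm ℝ (S : E →ₗ[ℝ] E) (T : E →ₗ[ℝ] E)

theorem IsFrame.traceL_eq {n : ℕ} {B : Bil E} {e : Fin n → E} (he : IsFrame B e)
    (hn : finrank ℝ E = n) (T : E →L[ℝ] E) : traceL E T = ∑ i, B (T (e i)) (e i) :=
  he.trace_eq hn T

/-- The trace of the bilinear form `β` with respect to `B`. -/
noncomputable def trBil (B β : Bil E) : ℝ := traceL E (B.inverse.comp β)

theorem IsInner.trBil_eq {n : ℕ} {B : Bil E} (hB : IsInner B) {e : Fin n → E} (he : IsFrame B e)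
    (hn : finrank ℝ E = n) (β : Bil E) : trBil B β = ∑ i, β (e i) (e i) := by
  rw [trBil, he.traceL_eq hn]
  exact Finset.sum_congr rfl fun i _ => hB.inverse_apply _ _

variable {Ω : Set E} {G : E → Bil E}

theorem LocalMetric.differentiableAt_inverse (hG : LocalMetric Ω G) {y : E} (hy : y ∈ Ω) :
    DifferentiableAt ℝ (fun z => (G z).inverse) y :=
  (hG.contDiffOn_inverse.contDiffAt (hG.isOpen.mem_nhds hy)).differentiableAt (by simp)

theorem LocalMetric.contDiffOn_trBil (hG : LocalMetric Ω G) {β : E → Bil E}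
    (hβ : ContDiffOn ℝ ∞ β Ω) : ContDiffOn ℝ ∞ (fun z => trBil (G z) (β z)) Ω :=
  (traceL E).contDiff.comp_contDiffOn (hG.contDiffOn_inverse.clm_comp hβ)

/-- Differentiate G(G⁻¹α, v) = α(v), whose right-hand side is constant. -/
theorem LocalMetric.fderiv_inverse (hG : LocalMetric Ω G) {y : E} (hy : y ∈ Ω) (a : E)
    (α : E →L[ℝ] ℝ) (v : E) :
    G y (fderiv ℝ (fun z => (G z).inverse) y a α) v = - fderiv ℝ G y a ((G y).inverse α) v := by
  have dP := hG.differentiableAt_inverse hy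
  have h : fderiv ℝ (fun z => G z ((G z).inverse α) v) y a = 0 := by
    have : (fun z => G z ((G z).inverse α) v) =ᶠ[𝓝 y] fun _ => α v := by
      filter_upwards [hG.isOpen.mem_nhds hy] with z hz using (hG.inner z hz).inverse_apply _ _
    rw [this.fderiv_eq]; simp
  have dα : DifferentiableAt ℝ (fun z => (G z).inverse α) y :=
    dP.clm_apply (differentiableAt_const α)
  have e2 : fderiv ℝ (fun z => (G z).inverse α) y a = fderiv ℝ (fun z => (G z).inverse) y a α := by
    rw [fderiv_clm_apply dP (differentiableAt_const α)]; simp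
  rw [fderiv_apply₂ (hG.differentiableAt hy) dα (differentiableAt_const v), e2] at h
  simp only [fderiv_fun_const, Pi.zero_apply, zero_apply, map_zero] at h
  linarith

/-- The covariant derivative commutes with the metric trace. -/
theorem LocalMetric.fderiv_trBil (hG : LocalMetric Ω G) {y : E} (hy : y ∈ Ω) {β : E → Bil E}
    (hβ : DifferentiableAt ℝ β y) {n : ℕ} (hn : finrank ℝ E = n) {e : Fin n → E}
    (he : IsFrame (G y) e) (a : E) :
    fderiv ℝ (fun z => trBil (G z) (β z)) y a = ∑ i, nablaBil G β y a (e i) (e i) := by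
  have hi := hG.inner y hy
  have dP := hG.differentiableAt_inverse hy
  have h1 : fderiv ℝ (fun z => trBil (G z) (β z)) y a =
      traceL E ((fderiv ℝ (fun z => (G z).inverse) y a).comp (β y)
        + (G y).inverse.comp (fderiv ℝ β y a)) := by
    unfold trBil
    have hd : DifferentiableAt ℝ (fun z => (G z).inverse.comp (β z)) y := dP.clm_comp hβ
    have hc : HasFDerivAt (fun z => traceL E ((G z).inverse.comp (β z))) _ y :=
      (traceL E).hasFDerivAt.comp y hd.hasFDerivAt
    rw [hc.fderiv, fderiv_clm_comp dP hβ]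
    simp [add_comm]
  -- The traces of Γ_a ∘ T and T ∘ Γ_a agree, for T = G⁻¹β.
  have h2 : ∑ i, G y (christoffel G y a ((G y).inverse (β y (e i)))) (e i) =
      ∑ i, β y (christoffel G y a (e i)) (e i) := by
    have := traceL_comp_comm (christoffel G y a) ((G y).inverse.comp (β y))
    rw [he.traceL_eq hn, he.traceL_eq hn] at this
    simpa [hi.inverse_apply] using this
  rw [h1, he.traceL_eq hn]
  simp only [nablaBil, Finset.sum_sub_distrib, ← h2, add_apply, map_add, Finset.sum_add_distrib,
    ContinuousLinearMap.comp_apply, hG.fderiv_inverse hy, hi.inverse_apply, hG.fderiv_eq hy]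
  simp only [Finset.sum_neg_distrib, Finset.sum_add_distrib]
  ring

/-- The Ricci curvature `Ric(b, c) = tr (a ↦ R(a, b) c)`. -/
noncomputable def ric (G : E → Bil E) (y : E) : Bil E :=
  (ContinuousLinearMap.compL ℝ E (E →L[ℝ] E) ℝ (traceL E)).comp
    (((ContinuousLinearMap.flipₗᵢ ℝ E E E).toContinuousLinearEquiv :
      (E →L[ℝ] E →L[ℝ] E) →L[ℝ] (E →L[ℝ] E →L[ℝ] E)).comp (curv G y).flip)

theorem ric_apply (G : E → Bil E) (y b c : E) :
    ric G y b c = traceL E (((curv G y).flip b).flip c) := rfl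

theorem IsFrame.ric_eq {n : ℕ} {B : Bil E} {e : Fin n → E} (he : IsFrame B e)
    (hn : finrank ℝ E = n) (G : E → Bil E) (y b c : E) :
    ric G y b c = ∑ i, B (curv G y (e i) b c) (e i) := by
  rw [ric_apply, he.traceL_eq hn]
  simp

theorem LocalMetric.contDiffOn_ric (hG : LocalMetric Ω G) : ContDiffOn ℝ ∞ (ric G) Ω := by
  refine contDiffOn_clm_apply.2 fun b => contDiffOn_clm_apply.2 fun c => ?_
  simp only [ric_apply]
  refine (traceL E).contDiff.comp_contDiffOn (contDiffOn_clm_apply.2 fun a => ?_)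
  simp only [ContinuousLinearMap.flip_apply]
  exact ((hG.contDiffOn_curv.clm_apply contDiffOn_const).clm_apply contDiffOn_const).clm_apply
    contDiffOn_const

/-- The covariant derivative passes through the contraction defining Ric: the two Christoffel terms
in the contracted slots cancel as the trace of a commutator. -/
theorem LocalMetric.nablaBil_ric (hG : LocalMetric Ω G) {y : E} (hy : y ∈ Ω) {n : ℕ}
    (hn : finrank ℝ E = n) {e : Fin n → E} (he : IsFrame (G y) e) (a b c : E) :
    nablaBil G (ric G) y a b c = ∑ i, G y (nablaCurv G y a (e i) b c) (e i) := by
  have dR := hG.differentiableAt_curv hy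
  have dRic : DifferentiableAt ℝ (ric G) y :=
    (hG.contDiffOn_ric.contDiffAt (hG.isOpen.mem_nhds hy)).differentiableAt (by simp)
  have h1 : fderiv ℝ (ric G) y a b c = ∑ i, G y (fderiv ℝ (curv G) y a (e i) b c) (e i) := by
    have hT : ∀ z, ric G z b c = ∑ i, G y (curv G z (e i) b c) (e i) := fun z => he.ric_eq hn G z b c
    rw [← fderiv_const₂ dRic]
    simp only [hT]
    rw [fderiv_fun_sum (fun i _ => by fun_prop), sum_apply]
    refine Finset.sum_congr rfl fun i _ => ?_
    rw [fderiv_const₁ (H := fun z => G y (curv G z (e i) b c)) (by fun_prop)]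
    have : fderiv ℝ (fun z => G y (curv G z (e i) b c)) y a =
        G y (fderiv ℝ (curv G) y a (e i) b c) := by
      have hd : DifferentiableAt ℝ (fun z => curv G z (e i) b c) y := by fun_prop
      have hc : HasFDerivAt (fun z => G y (curv G z (e i) b c)) _ y :=
        (G y).hasFDerivAt.comp y hd.hasFDerivAt
      rw [hc.fderiv]
      simp [fderiv_const₃ dR]
    rw [this]
  have h2 : ∑ i, G y (christoffel G y a (curv G y (e i) b c)) (e i) =
      ∑ i, G y (curv G y (christoffel G y a (e i)) b c) (e i) := by
    have := traceL_comp_comm (christoffel G y a) (((curv G y).flip b).flip c)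
    rw [he.traceL_eq hn, he.traceL_eq hn] at this
    simpa using this
  simp only [nablaBil, nablaCurv, h1, he.ric_eq hn, map_sub, map_add, sub_apply, add_apply,
    Finset.sum_sub_distrib, Finset.sum_add_distrib, h2]
  ring

/-- The contracted second Bianchi identity. -/
theorem LocalMetric.contracted_bianchi (hG : LocalMetric Ω G) {y : E} (hy : y ∈ Ω) {n : ℕ}
    (hn : finrank ℝ E = n) {e : Fin n → E} (he : IsFrame (G y) e) (a : E) :
    fderiv ℝ (fun z => trBil (G z) (ric G z)) y a = 2 * ∑ i, nablaBil G (ric G) y (e i) a (e i) := by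
  have dRic : DifferentiableAt ℝ (ric G) y :=
    (hG.contDiffOn_ric.contDiffAt (hG.isOpen.mem_nhds hy)).differentiableAt (by simp)
  rw [hG.fderiv_trBil hy dRic hn he]
  simp only [hG.nablaBil_ric hy hn he]
  have hswap : ∀ a b c d : E, nablaCurv G y a b c d = - nablaCurv G y a c b d := by
    intro a b c d
    have h0 : fderiv ℝ (curv G) y a b c d = - fderiv ℝ (curv G) y a c b d := by
      have dR := hG.differentiableAt_curv hy
      rw [← fderiv_const₃ dR, ← fderiv_const₃ dR]
      simp only [fun z => curv_swap G z b c d]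
      simp [fderiv_fun_neg]
    simp only [nablaCurv, h0, curv_swap G y b, curv_swap G y (christoffel G y a b),
      map_neg]
    abel
  -- Bianchi applied to e_j and paired with e_i; skewness changes the sign of one term and
  -- antisymmetry in the first curvature pair that of the other. The two terms on the right differ
  -- only by exchanging i and j, so after summation they are equal; this is the factor 2.
  have hB : ∀ i j, G y (nablaCurv G y a (e i) (e j) (e j)) (e i) =
      G y (nablaCurv G y (e i) (e j) a (e i)) (e j)
      + G y (nablaCurv G y (e j) (e i) a (e j)) (e i) := by
    intro i j
    have h := congrArg (fun v => G y v (e i)) (hG.bianchi hy a (e i) (e j) (e j))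
    simp only [map_add, add_apply, map_zero, zero_apply] at h
    rw [hG.nablaCurv_skew hy (e i), (hG.inner y hy).symm (e j),
      hswap (e j) a] at h
    simp only [map_neg, neg_apply] at h
    linarith
  simp only [hB, Finset.sum_add_distrib]
  rw [Finset.sum_comm, two_mul]

omit [FiniteDimensional ℝ E] in
theorem nablaBil_symm {y : E} (hΩ : IsOpen Ω) (hy : y ∈ Ω) {β : E → Bil E}
    (hs : ∀ y ∈ Ω, ∀ v w, β y v w = β y w v) (hβ : DifferentiableAt ℝ β y) (a b c : E) :
    nablaBil G β y a b c = nablaBil G β y a c b := by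
  simp only [nablaBil, LocalGeom.fderiv_symm hΩ hs hy hβ a b c, hs y hy _ c, hs y hy b]
  ring

/-- The difference of the Levi-Civita connections of two metrics. -/
theorem LocalMetric.christoffel_sub (hG : LocalMetric Ω G) {H : E → Bil E} (hH : LocalMetric Ω H)
    {y : E} (hy : y ∈ Ω) (v w z : E) :
    H y (christoffel H y v w - christoffel G y v w) z =
      (1 / 2) * (nablaBil G H y v w z + nablaBil G H y w v z - nablaBil G H y z v w) := by
  have hs := (hH.inner y hy).symm
  rw [map_sub, sub_apply, hH.christoffel_spec hy]
  simp only [nablaBil, hG.christoffel_symm hy w v, hG.christoffel_symm hy z v,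
    hG.christoffel_symm hy z w]
  rw [hs w, hs v (christoffel G y w z)]
  ring

/-- The tension field of the identity map from `G` to `H`. -/
theorem LocalMetric.tension (hG : LocalMetric Ω G) {H : E → Bil E} (hH : LocalMetric Ω H)
    {y : E} (hy : y ∈ Ω) {n : ℕ} (hn : finrank ℝ E = n) {e : Fin n → E} (he : IsFrame (G y) e)
    (z : E) :
    H y (∑ i, (christoffel H y (e i) (e i) - christoffel G y (e i) (e i))) z =
      ∑ i, nablaBil G H y (e i) (e i) z
        - (1 / 2) * fderiv ℝ (fun x => trBil (G x) (H x)) y z := by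
  rw [hG.fderiv_trBil hy (hH.differentiableAt hy) hn he, Finset.mul_sum,
    ← Finset.sum_sub_distrib]
  simp only [map_sum, sum_apply, hG.christoffel_sub hH hy]
  refine Finset.sum_congr rfl fun i _ => ?_
  ring

/-- The Lie derivative of the field of bilinear forms `G` along the vector field `ξ`. -/
noncomputable def lieBil (ξ : E → E) (G : E → Bil E) (y : E) : Bil E :=
  fderiv ℝ G y (ξ y) + (G y).comp (fderiv ℝ ξ y) + ((G y).flip.comp (fderiv ℝ ξ y)).flip

omit [FiniteDimensional ℝ E] in
theorem lieBil_apply (ξ : E → E) (G : E → Bil E) (y v w : E) :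
    lieBil ξ G y v w = fderiv ℝ G y (ξ y) v w + G y (fderiv ℝ ξ y v) w
      + G y v (fderiv ℝ ξ y w) := by
  simp [lieBil]

theorem contDiffOn_lieBil {ξ : E → E} (hΩ : IsOpen Ω) (hξ : ContDiffOn ℝ ∞ ξ Ω)
    (hG : ContDiffOn ℝ ∞ G Ω) : ContDiffOn ℝ ∞ (lieBil ξ G) Ω := by
  have h1 : ContDiffOn ℝ ∞ (fderiv ℝ G) Ω := hG.fderiv_of_isOpen hΩ (by simp)
  have h2 : ContDiffOn ℝ ∞ (fderiv ℝ ξ) Ω := hξ.fderiv_of_isOpen hΩ (by simp)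
  refine contDiffOn_clm_apply.2 fun b => contDiffOn_clm_apply.2 fun c => ?_
  simp only [lieBil_apply]
  exact (((h1.clm_apply hξ).clm_apply contDiffOn_const).clm_apply contDiffOn_const).add
    ((hG.clm_apply (h2.clm_apply contDiffOn_const)).clm_apply contDiffOn_const) |>.add
    ((hG.clm_apply contDiffOn_const).clm_apply (h2.clm_apply contDiffOn_const))

/-- The Lie derivative of the connection `Γ` along the vector field `ξ`. -/
noncomputable def lieConn (Γ : E → E →L[ℝ] E →L[ℝ] E) (ξ : E → E) (y v w : E) : E :=
  fderiv ℝ Γ y (ξ y) v w - fderiv ℝ ξ y (Γ y v w) + Γ y (fderiv ℝ ξ y v) w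
    + Γ y v (fderiv ℝ ξ y w) + fderiv ℝ (fderiv ℝ ξ) y v w

/-- The variation of the Levi-Civita connection under a variation of the metric by a flow. -/
theorem LocalMetric.lieConn_eq (hG : LocalMetric Ω G) {ξ : E → E} (hξ : ContDiffOn ℝ ∞ ξ Ω)
    {y : E} (hy : y ∈ Ω) (v w z : E) :
    G y (lieConn (christoffel G) ξ y v w) z =
      (1 / 2) * (nablaBil G (lieBil ξ G) y v w z + nablaBil G (lieBil ξ G) y w v z
        - nablaBil G (lieBil ξ G) y z v w) := by
  have dG := hG.differentiableAt hy
  have dΓ := hG.differentiableAt_christoffel hy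
  have cξ := hξ.contDiffAt (hG.isOpen.mem_nhds hy)
  have dξ : DifferentiableAt ℝ ξ y := cξ.differentiableAt (by simp)
  have ddξ : DifferentiableAt ℝ (fderiv ℝ ξ) y :=
    (contDiffAt_fderiv cξ).differentiableAt (by simp)
  have ddG : DifferentiableAt ℝ (fderiv ℝ G) y :=
    (contDiffAt_fderiv (hG.contDiffAt hy)).differentiableAt (by simp)
  have dk : DifferentiableAt ℝ (lieBil ξ G) y :=
    ((contDiffOn_lieBil hG.isOpen hξ hG.smooth).contDiffAt
      (hG.isOpen.mem_nhds hy)).differentiableAt (by simp)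
  have sG := fderiv_fderiv_symm (hG.contDiffAt hy)
  have sξ := fderiv_fderiv_symm cξ
  have hs := (hG.inner y hy).symm
  have hk : ∀ a b c : E, fderiv ℝ (lieBil ξ G) y a b c =
      fderiv ℝ (fderiv ℝ G) y a (ξ y) b c + fderiv ℝ G y (fderiv ℝ ξ y a) b c
      + (fderiv ℝ G y a (fderiv ℝ ξ y b) c + G y (fderiv ℝ (fderiv ℝ ξ) y a b) c)
      + (fderiv ℝ G y a b (fderiv ℝ ξ y c) + G y b (fderiv ℝ (fderiv ℝ ξ) y a c)) := by
    intro a b c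
    rw [← fderiv_const₂ dk]
    simp only [lieBil_apply]
    rw [fderiv_fun_add (by fun_prop) (by fun_prop), fderiv_fun_add (by fun_prop) (by fun_prop)]
    simp only [add_apply]
    rw [fderiv_apply₂ dG (by fun_prop) (by fun_prop), fderiv_apply₂ dG (by fun_prop) (by fun_prop),
      fderiv_const₁ ddξ, fderiv_const₁ ddξ, fderiv_const₂ (H := fun z => fderiv ℝ G z (ξ z))
      (by fun_prop), fderiv_apply₁ ddG dξ]
    simp
  -- The derivative along ξ of the Koszul relation defining Γ, with the second derivatives of G
  -- reordered to match those in `hk`.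
  have hΓ : fderiv ℝ G y (ξ y) (christoffel G y v w) z
      + G y (fderiv ℝ (christoffel G) y (ξ y) v w) z =
      (1 / 2) * (fderiv ℝ (fderiv ℝ G) y v (ξ y) w z + fderiv ℝ (fderiv ℝ G) y w (ξ y) v z
        - fderiv ℝ (fderiv ℝ G) y z (ξ y) v w) := by
    have h : (fun x => G x (christoffel G x v w) z) =ᶠ[𝓝 y] fun x =>
        (1 / 2) * (fderiv ℝ G x v w z + fderiv ℝ G x w v z - fderiv ℝ G x z v w) := by
      filter_upwards [hG.isOpen.mem_nhds hy] with x hx using hG.christoffel_spec hx v w z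
    have h' := congrArg (fun T : E →L[ℝ] ℝ => T (ξ y)) h.fderiv_eq
    rw [fderiv_apply₂ dG (by fun_prop) (by fun_prop), fderiv_const₂ dΓ,
      fderiv_const_mul (by fun_prop), smul_apply,
      fderiv_fun_sub (by fun_prop) (by fun_prop), fderiv_fun_add (by fun_prop) (by fun_prop),
      sub_apply, add_apply, fderiv_const₃ ddG, fderiv_const₃ ddG, fderiv_const₃ ddG,
      sG (ξ y) v, sG (ξ y) w, sG (ξ y) z] at h'
    simpa using h'
  -- The terms of L_ξ∇ and ∇(L_ξ G) that involve dξ are Koszul relations with one slot replaced by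
  -- its image under dξ.
  have c1 := hG.christoffel_spec hy (fderiv ℝ ξ y v) w z
  have c2 := hG.christoffel_spec hy v (fderiv ℝ ξ y w) z
  have c3 := hG.christoffel_spec hy v w (fderiv ℝ ξ y z)
  simp only [nablaBil, hk, lieBil_apply, lieConn, map_add, map_sub, add_apply, sub_apply, c1, c2,
    hG.christoffel_symm hy w v, hG.christoffel_symm hy z v, hG.christoffel_symm hy z w,
    sξ w v, sξ z v, sξ z w]
  have f := hG.fderiv_symm hy (ξ y) w (christoffel G y v z)
  have s1 := hs (fderiv ℝ ξ y w) (christoffel G y v z)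
  have s2 := hs w (fderiv ℝ ξ y (christoffel G y v z))
  have s3 := hs w (fderiv ℝ (fderiv ℝ ξ) y v z)
  linarith

end LocalGeom

/-! ### The two pointwise conclusions: vanishing tension and dλ = 0 -/

namespace LocalGeom

open Module Filter Topology

variable {E : Type*} [NormedAddCommGroup E] [NormedSpace ℝ E] [FiniteDimensional ℝ E]
  {Ω : Set E} {G : E → Bil E} {n : ℕ}

/-- If the Ricci tensor is a metric, the identity map into it is harmonic. -/
theorem LocalMetric.tension_ric_eq_zero (hG : LocalMetric Ω G) (hR : LocalMetric Ω (ric G))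
    {y : E} (hy : y ∈ Ω) (hn : finrank ℝ E = n) {e : Fin n → E} (he : IsFrame (G y) e) :
    ∑ i, (christoffel (ric G) y (e i) (e i) - christoffel G y (e i) (e i)) = 0 := by
  refine (hR.inner y hy).eq_of_forall fun z => ?_
  have hs : ∀ i, nablaBil G (ric G) y (e i) (e i) z = nablaBil G (ric G) y (e i) z (e i) :=
    fun i => nablaBil_symm hR.isOpen hy (fun x hx => (hR.inner x hx).symm)
      (hR.differentiableAt hy) _ _ _
  rw [hG.tension hR hy hn he, hG.contracted_bianchi hy hn he]
  simp only [hs, map_zero, zero_apply]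
  ring

/-- The trace of the Lie derivative of the Levi-Civita connection. -/
theorem LocalMetric.sum_lieConn (hG : LocalMetric Ω G) {ξ : E → E} (hξ : ContDiffOn ℝ ∞ ξ Ω)
    {y : E} (hy : y ∈ Ω) (hn : finrank ℝ E = n) {e : Fin n → E} (he : IsFrame (G y) e) (z : E) :
    G y (∑ i, lieConn (christoffel G) ξ y (e i) (e i)) z =
      ∑ i, nablaBil G (lieBil ξ G) y (e i) (e i) z
        - (1 / 2) * fderiv ℝ (fun x => trBil (G x) (lieBil ξ G x)) y z := by
  have dk : DifferentiableAt ℝ (lieBil ξ G) y :=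
    ((contDiffOn_lieBil hG.isOpen hξ hG.smooth).contDiffAt
      (hG.isOpen.mem_nhds hy)).differentiableAt (by simp)
  rw [hG.fderiv_trBil hy dk hn he, Finset.mul_sum, ← Finset.sum_sub_distrib]
  simp only [map_sum, sum_apply, hG.lieConn_eq hξ hy]
  refine Finset.sum_congr rfl fun i _ => ?_
  ring

theorem LocalMetric.trBil_york (hG : LocalMetric Ω G) {R K P : Bil E} {c : ℝ} {y : E} (hy : y ∈ Ω)
    (hn : finrank ℝ E = n)
    (h : ∀ v w, R v w = (1 / 2) * K v w + c * G y v w + P v w) (hP : trBil (G y) P = 0) :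
    trBil (G y) R = (1 / 2) * trBil (G y) K + n * c := by
  have hi := hG.inner y hy
  obtain ⟨e, he⟩ := hi.exists_frame hn
  rw [hi.trBil_eq he hn] at hP ⊢
  rw [hi.trBil_eq he hn]
  simp only [h, Finset.sum_add_distrib, hP, ← Finset.mul_sum, he _ _]
  simp [mul_comm]

/-- In the York decomposition `Ric = ½ L_ξ g + λ g + φ` with `φ` a TT-tensor and `ξ` an infinitesimal
harmonic transformation, `λ` has vanishing differential when `n ≥ 3`. -/
theorem LocalMetric.fderiv_eq_zero_of_york (hG : LocalMetric Ω G) {ξ : E → E}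
    (hξ : ContDiffOn ℝ ∞ ξ Ω) {lam : E → ℝ} (hlam : ContDiffOn ℝ ∞ lam Ω) {φ : E → Bil E}
    (hφ : ContDiffOn ℝ ∞ φ Ω) (hs : ∀ y ∈ Ω, ∀ v w, ric G y v w = ric G y w v)
    (hYork : ∀ y ∈ Ω, ∀ v w,
      ric G y v w = (1 / 2) * lieBil ξ G y v w + lam y * G y v w + φ y v w)
    (htr : ∀ y ∈ Ω, trBil (G y) (φ y) = 0) {y : E} (hy : y ∈ Ω) (hn : finrank ℝ E = n)
    (h3 : 3 ≤ n) {e : Fin n → E} (he : IsFrame (G y) e)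
    (hdiv : ∀ z, ∑ i, nablaBil G φ y (e i) (e i) z = 0)
    (hharm : ∑ i, lieConn (christoffel G) ξ y (e i) (e i) = 0) :
    fderiv ℝ lam y = 0 := by
  have hΩ := hG.isOpen.mem_nhds hy
  have dG := hG.differentiableAt hy
  have dR : DifferentiableAt ℝ (ric G) y :=
    (hG.contDiffOn_ric.contDiffAt hΩ).differentiableAt (by simp)
  have dk : DifferentiableAt ℝ (lieBil ξ G) y :=
    ((contDiffOn_lieBil hG.isOpen hξ hG.smooth).contDiffAt hΩ).differentiableAt (by simp)
  have dl : DifferentiableAt ℝ lam y := (hlam.contDiffAt hΩ).differentiableAt (by simp)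
  have dφ : DifferentiableAt ℝ φ y := (hφ.contDiffAt hΩ).differentiableAt (by simp)
  have dt : DifferentiableAt ℝ (fun x => trBil (G x) (lieBil ξ G x)) y :=
    ((hG.contDiffOn_trBil (contDiffOn_lieBil hG.isOpen hξ hG.smooth)).contDiffAt
      hΩ).differentiableAt (by simp)
  ext z
  have h1 := hG.sum_lieConn hξ hy hn he z
  rw [hharm] at h1
  simp only [map_zero, zero_apply] at h1
  have h2 := hG.contracted_bianchi hy hn he z
  have h3' : fderiv ℝ (fun x => trBil (G x) (ric G x)) y z =
      (1 / 2) * fderiv ℝ (fun x => trBil (G x) (lieBil ξ G x)) y z + n * fderiv ℝ lam y z := by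
    have : (fun x => trBil (G x) (ric G x)) =ᶠ[𝓝 y] fun x =>
        (1 / 2) * trBil (G x) (lieBil ξ G x) + n * lam x := by
      filter_upwards [hΩ] with x hx using hG.trBil_york hx hn (hYork x hx) (htr x hx)
    rw [this.fderiv_eq, fderiv_fun_add (by fun_prop) (by fun_prop),
      fderiv_const_mul (by fun_prop), fderiv_const_mul (by fun_prop)]
    simp
  -- Since ∇G = 0, the covariant derivative of λG is dλ ⊗ G.
  have h4 : ∀ a b c, nablaBil G (ric G) y a b c = (1 / 2) * nablaBil G (lieBil ξ G) y a b c
      + fderiv ℝ lam y a * G y b c + nablaBil G φ y a b c := by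
    intro a b c
    have : (fun x => ric G x b c) =ᶠ[𝓝 y] fun x =>
        (1 / 2) * lieBil ξ G x b c + lam x * G x b c + φ x b c := by
      filter_upwards [hΩ] with x hx using hYork x hx b c
    have h5 : fderiv ℝ (ric G) y a b c = (1 / 2) * fderiv ℝ (lieBil ξ G) y a b c
        + (lam y * fderiv ℝ G y a b c + fderiv ℝ lam y a * G y b c) + fderiv ℝ φ y a b c := by
      rw [← fderiv_const₂ dR, this.fderiv_eq, fderiv_fun_add (by fun_prop) (by fun_prop),
        fderiv_fun_add (by fun_prop) (by fun_prop), fderiv_const_mul (by fun_prop),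
        fderiv_fun_mul (by fun_prop) (by fun_prop)]
      simp only [add_apply, smul_apply, smul_eq_mul, fderiv_const₂ dG, fderiv_const₂ dφ,
        fderiv_const₂ dk]
      ring
    simp only [nablaBil, h5, hYork y hy, hG.fderiv_eq hy]
    ring
  have h6 : ∀ i, nablaBil G (ric G) y (e i) z (e i) = nablaBil G (ric G) y (e i) (e i) z :=
    fun i => nablaBil_symm hG.isOpen hy hs dR _ _ _
  have h7 : ∑ i, fderiv ℝ lam y (e i) * G y (e i) z = fderiv ℝ lam y z := by
    have := he.sum_left hn (fderiv ℝ lam y : E →ₗ[ℝ] ℝ) z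
    rw [← ContinuousLinearMap.coe_coe, ← this]
    refine Finset.sum_congr rfl fun i _ => ?_
    rw [(hG.inner y hy).symm (e i) z, smul_eq_mul, mul_comm]
  simp only [h6, h4, Finset.sum_add_distrib, h7, hdiv z, ← Finset.mul_sum, h3'] at h2
  -- With K = L_ξ G, the contracted Bianchi identity reads ½ d tr K + n dλ = div K + 2 dλ, and
  -- infinitesimal harmonicity reads div K = ½ d tr K.
  have h8 : (n - 2 : ℝ) * fderiv ℝ lam y z = 0 := by linarith
  have h9 : (n - 2 : ℝ) ≠ 0 := by
    have : (3 : ℝ) ≤ n := by exact_mod_cast h3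
    linarith
  simpa [h9] using h8

end LocalGeom

/-! ### Vector fields and their brackets in a chart -/

namespace RiemGeom

open Module Filter Topology LocalGeom VectorField

variable {n : ℕ} {M : Type*} [TopologicalSpace M] [ChartedSpace (EuclideanSpace ℝ (Fin n)) M]

/-- The differential of the inverse of the chart at `c`, identifying the model space with the
tangent spaces. -/
noncomputable def chartFrame (c : M) (y : EuclideanSpace ℝ (Fin n)) :
    (EuclideanSpace ℝ (Fin n)) →L[ℝ] TangentSpace (𝓡 n) ((extChartAt (𝓡 n) c).symm y) :=
  mfderiv 𝓘(ℝ, (EuclideanSpace ℝ (Fin n))) (𝓡 n) (extChartAt (𝓡 n) c).symm y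

/-- The vector field `X` has the coordinate expression `V` near `y` in the chart at `c`. -/
def Represents (c : M) (X : VField n M) (V : EuclideanSpace ℝ (Fin n) → EuclideanSpace ℝ (Fin n)) (y : EuclideanSpace ℝ (Fin n)) : Prop :=
  ∀ᶠ z in 𝓝 y, X ((extChartAt (𝓡 n) c).symm z) = chartFrame c z (V z)

theorem Represents.eventually {c : M} {X : VField n M} {V : EuclideanSpace ℝ (Fin n) → EuclideanSpace ℝ (Fin n)} {y : EuclideanSpace ℝ (Fin n)}
    (h : Represents c X V y) : ∀ᶠ z in 𝓝 y, Represents c X V z :=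
  eventually_eventually_nhds.2 h

theorem Represents.eq {c : M} {X : VField n M} {V : EuclideanSpace ℝ (Fin n) → EuclideanSpace ℝ (Fin n)} {y : EuclideanSpace ℝ (Fin n)}
    (h : Represents c X V y) : X ((extChartAt (𝓡 n) c).symm y) = chartFrame c y (V y) :=
  h.self_of_nhds

variable [IsManifold (𝓡 n) ∞ M] {c : M} {y : EuclideanSpace ℝ (Fin n)}

theorem chartFrame_isInvertible (hy : y ∈ (extChartAt (𝓡 n) c).target) :
    (chartFrame c y).IsInvertible := by
  have : IsManifold (𝓡 n) 1 M := IsManifold.of_le (n := ∞) ENat.LEInfty.out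
  have h := isInvertible_mfderivWithin_extChartAt_symm (I := 𝓡 n) hy
  rwa [ModelWithCorners.range_eq_univ, mfderivWithin_univ] at h

theorem chartFrame_inverse_apply (hy : y ∈ (extChartAt (𝓡 n) c).target) (v : EuclideanSpace ℝ (Fin n)) :
    (chartFrame c y).inverse (chartFrame c y v) = v := by
  obtain ⟨e, he⟩ := chartFrame_isInvertible hy
  rw [← he, ContinuousLinearMap.inverse_equiv]
  exact e.symm_apply_apply v

theorem chartFrame_apply_inverse (hy : y ∈ (extChartAt (𝓡 n) c).target)
    (v : TangentSpace (𝓡 n) ((extChartAt (𝓡 n) c).symm y)) :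
    chartFrame c y ((chartFrame c y).inverse v) = v := by
  obtain ⟨e, he⟩ := chartFrame_isInvertible hy
  rw [← he, ContinuousLinearMap.inverse_equiv]
  exact e.apply_symm_apply v

theorem chartFrame_surjective (hy : y ∈ (extChartAt (𝓡 n) c).target) :
    Function.Surjective (chartFrame c y) := fun v => ⟨_, chartFrame_apply_inverse hy v⟩

theorem chartFrame_injective (hy : y ∈ (extChartAt (𝓡 n) c).target) :
    Function.Injective (chartFrame c y) := fun v w h => by
  rw [← chartFrame_inverse_apply hy v, h, chartFrame_inverse_apply hy w]

omit [IsManifold (𝓡 n) ∞ M] in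
theorem target_mem_nhds (hy : y ∈ (extChartAt (𝓡 n) c).target) :
    (extChartAt (𝓡 n) c).target ∈ 𝓝 y :=
  (isOpen_extChartAt_target (I := 𝓡 n) c).mem_nhds hy

theorem contMDiffAt_symm (hy : y ∈ (extChartAt (𝓡 n) c).target) :
    ContMDiffAt 𝓘(ℝ, (EuclideanSpace ℝ (Fin n))) (𝓡 n) ∞ (extChartAt (𝓡 n) c).symm y :=
  (contMDiffOn_extChartAt_symm c).contMDiffAt (target_mem_nhds hy)

theorem contMDiffAt_chart (hy : y ∈ (extChartAt (𝓡 n) c).target) :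
    ContMDiffAt (𝓡 n) 𝓘(ℝ, (EuclideanSpace ℝ (Fin n))) ∞ (extChartAt (𝓡 n) c) ((extChartAt (𝓡 n) c).symm y) := by
  refine contMDiffAt_extChartAt' ?_
  rw [← extChartAt_source (𝓡 n)]
  exact (extChartAt (𝓡 n) c).map_target hy

omit [IsManifold (𝓡 n) ∞ M] in
theorem source_mem_nhds (hy : y ∈ (extChartAt (𝓡 n) c).target) :
    (extChartAt (𝓡 n) c).source ∈ 𝓝 ((extChartAt (𝓡 n) c).symm y) :=
  (isOpen_extChartAt_source (I := 𝓡 n) c).mem_nhds ((extChartAt (𝓡 n) c).map_target hy)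

/-- Smoothness of a function can be tested in a chart. -/
theorem mdifferentiableAt_of_chart {F : Type*} [NormedAddCommGroup F] [NormedSpace ℝ F] {f : M → F}
    (hy : y ∈ (extChartAt (𝓡 n) c).target)
    (hf : DifferentiableAt ℝ (fun z => f ((extChartAt (𝓡 n) c).symm z)) y) :
    MDifferentiableAt (𝓡 n) 𝓘(ℝ, F) f ((extChartAt (𝓡 n) c).symm y) := by
  have h1 : MDifferentiableAt (𝓡 n) 𝓘(ℝ, F)
      ((fun z => f ((extChartAt (𝓡 n) c).symm z)) ∘ extChartAt (𝓡 n) c)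
      ((extChartAt (𝓡 n) c).symm y) := by
    refine MDifferentiableAt.comp (I' := 𝓘(ℝ, (EuclideanSpace ℝ (Fin n)))) _ ?_
      ((contMDiffAt_chart hy).mdifferentiableAt (by simp))
    rw [(extChartAt (𝓡 n) c).right_inv hy]
    exact hf.mdifferentiableAt
  refine h1.congr_of_eventuallyEq ?_
  filter_upwards [source_mem_nhds hy] with x hx
  rw [Function.comp_apply, (extChartAt (𝓡 n) c).left_inv hx]

theorem dirDeriv_chartFrame {f : M → ℝ} (hy : y ∈ (extChartAt (𝓡 n) c).target)
    (hf : DifferentiableAt ℝ (fun z => f ((extChartAt (𝓡 n) c).symm z)) y) (a : EuclideanSpace ℝ (Fin n)) :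
    dirDeriv f ((extChartAt (𝓡 n) c).symm y) (chartFrame c y a) =
      fderiv ℝ (fun z => f ((extChartAt (𝓡 n) c).symm z)) y a := by
  have h := mfderiv_comp y (mdifferentiableAt_of_chart hy hf)
    ((contMDiffAt_symm hy).mdifferentiableAt (by simp))
  have h' := congrArg (fun T => T a) h
  rw [← mfderiv_eq_fderiv]
  exact h'.symm

/-- The vector field on the domain of the chart with a given coordinate expression. -/
theorem mpullback_chart {V : Π z : EuclideanSpace ℝ (Fin n), TangentSpace 𝓘(ℝ, EuclideanSpace ℝ (Fin n)) z}
    (hy : y ∈ (extChartAt (𝓡 n) c).target) :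
    mpullback (𝓡 n) 𝓘(ℝ, EuclideanSpace ℝ (Fin n)) (extChartAt (𝓡 n) c) V
      ((extChartAt (𝓡 n) c).symm y) = chartFrame c y (V y) := by
  have : IsManifold (𝓡 n) 1 M := IsManifold.of_le (n := ∞) ENat.LEInfty.out
  rw [mpullback_apply,
    (isInvertible_mfderiv_extChartAt ((extChartAt (𝓡 n) c).map_target hy)).inverse_apply_eq]
  have h4 := mfderiv_extChartAt_comp_mfderivWithin_extChartAt_symm (I := 𝓡 n) hy
  rw [ModelWithCorners.range_eq_univ, mfderivWithin_univ] at h4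
  refine Eq.trans ?_ (congrArg (fun T => T (V y)) h4).symm
  rw [(extChartAt (𝓡 n) c).right_inv hy]
  rfl

theorem Represents.mdifferentiableAt {X : VField n M} {V : EuclideanSpace ℝ (Fin n) → EuclideanSpace ℝ (Fin n)}
    (hX : Represents c X V y) (hy : y ∈ (extChartAt (𝓡 n) c).target)
    (hV : DifferentiableAt ℝ V y) :
    MDifferentiableAt (𝓡 n) (𝓡 n).tangent (fun x => TotalSpace.mk' (EuclideanSpace ℝ (Fin n)) x (X x))
      ((extChartAt (𝓡 n) c).symm y) := by
  have : IsManifold (𝓡 n) 1 M := IsManifold.of_le (n := ∞) ENat.LEInfty.out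
  let V' : Π z : (EuclideanSpace ℝ (Fin n)), TangentSpace 𝓘(ℝ, (EuclideanSpace ℝ (Fin n))) z := V
  have hV' : MDifferentiableAt 𝓘(ℝ, (EuclideanSpace ℝ (Fin n))) 𝓘(ℝ, (EuclideanSpace ℝ (Fin n))).tangent
      (fun z => TotalSpace.mk' (EuclideanSpace ℝ (Fin n)) z (V' z)) (extChartAt (𝓡 n) c ((extChartAt (𝓡 n) c).symm y)) := by
    rw [(extChartAt (𝓡 n) c).right_inv hy]
    rw [mdifferentiableAt_totalSpace]
    refine ⟨mdifferentiableAt_id, ?_⟩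
    simpa using hV.mdifferentiableAt
  have h1 := MDifferentiableAt.mpullback_vectorField (n := ∞) hV' (contMDiffAt_chart hy)
    (isInvertible_mfderiv_extChartAt ((extChartAt (𝓡 n) c).map_target hy)) ENat.LEInfty.out
  refine h1.congr_of_eventuallyEq ?_
  have h2 := (contMDiffAt_chart hy).continuousAt.tendsto
  rw [(extChartAt (𝓡 n) c).right_inv hy] at h2
  filter_upwards [h2.eventually hX, source_mem_nhds hy] with x hx hxs
  have h3 : X x = mpullback (𝓡 n) 𝓘(ℝ, (EuclideanSpace ℝ (Fin n))) (extChartAt (𝓡 n) c) V' x := by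
    obtain ⟨z, hz, rfl⟩ : ∃ z ∈ (extChartAt (𝓡 n) c).target, (extChartAt (𝓡 n) c).symm z = x :=
      ⟨_, (extChartAt (𝓡 n) c).map_source hxs, (extChartAt (𝓡 n) c).left_inv hxs⟩
    rw [(extChartAt (𝓡 n) c).right_inv hz] at hx
    rw [hx, mpullback_chart hz]
  rw [h3]

/-- The coordinate expression is the pullback of X along the inverse chart, and pullback by a local
diffeomorphism preserves smoothness. -/
theorem exists_represents {X : VField n M} (hy : y ∈ (extChartAt (𝓡 n) c).target)
    (hX : ContMDiffAt (𝓡 n) (𝓡 n).tangent ∞ (fun x => TotalSpace.mk' (EuclideanSpace ℝ (Fin n)) x (X x))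
      ((extChartAt (𝓡 n) c).symm y)) :
    ∃ V : EuclideanSpace ℝ (Fin n) → EuclideanSpace ℝ (Fin n), ContDiffAt ℝ ∞ V y ∧ Represents c X V y := by
  have : IsManifold (𝓡 n) 1 M := IsManifold.of_le (n := ∞) ENat.LEInfty.out
  refine ⟨mpullback 𝓘(ℝ, (EuclideanSpace ℝ (Fin n))) (𝓡 n) (extChartAt (𝓡 n) c).symm X, ?_, ?_⟩
  · rw [← contMDiffAt_vectorSpace_iff_contDiffAt]
    exact ContMDiffAt.mpullback_vectorField_preimage (n := ∞) hX (contMDiffAt_symm hy)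
      (chartFrame_isInvertible hy) (by simp)
  · filter_upwards [target_mem_nhds hy] with z hz
    exact (chartFrame_apply_inverse hz _).symm

/-- Only smoothness at the base point and the value there are retained. Every coordinate formula
below holds for an arbitrary V with these properties, so the choice made in `ext` is immaterial. -/
theorem exists_represents_ext (hy : y ∈ (extChartAt (𝓡 n) c).target) (a : EuclideanSpace ℝ (Fin n)) :
    ∃ V : EuclideanSpace ℝ (Fin n) → EuclideanSpace ℝ (Fin n), ContDiffAt ℝ ∞ V y ∧ Represents c (ext (chartFrame c y a)) V y ∧ V y = a := by
  obtain ⟨V, hV, hr⟩ := exists_represents (X := ext (chartFrame c y a)) hy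
    (FiberBundle.contMDiffAt_extend (𝓡 n) (EuclideanSpace ℝ (Fin n)) _)
  refine ⟨V, hV, hr, chartFrame_injective hy ?_⟩
  rw [← hr.eq]
  exact FiberBundle.extend_apply_self _ _

/-- The Lie bracket is natural under pullback by the inverse chart, and on the model space it is
dW(V) − dV(W). -/
theorem Represents.bracket {X Y : VField n M} {V W : EuclideanSpace ℝ (Fin n) → EuclideanSpace ℝ (Fin n)}
    (hX : Represents c X V y) (hY : Represents c Y W y)
    (hy : y ∈ (extChartAt (𝓡 n) c).target)
    (hV : DifferentiableAt ℝ V y) (hW : DifferentiableAt ℝ W y) :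
    bracket X Y ((extChartAt (𝓡 n) c).symm y) =
      chartFrame c y (fderiv ℝ W y (V y) - fderiv ℝ V y (W y)) := by
  have : IsManifold (𝓡 n) (minSmoothness ℝ 2) M := IsManifold.of_le (n := ∞) (by
    simp only [minSmoothness_of_isRCLikeNormedField]; exact ENat.LEInfty.out)
  have h := mpullback_mlieBracket (n := ∞) (hX.mdifferentiableAt hy hV)
    (hY.mdifferentiableAt hy hW) (contMDiffAt_symm hy) (by
    simp only [minSmoothness_of_isRCLikeNormedField]; exact ENat.LEInfty.out)
  have e : ∀ {X : VField n M} {V : EuclideanSpace ℝ (Fin n) → EuclideanSpace ℝ (Fin n)}, Represents c X V y →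
      mpullback 𝓘(ℝ, (EuclideanSpace ℝ (Fin n))) (𝓡 n) (extChartAt (𝓡 n) c).symm X =ᶠ[𝓝 y] V := by
    intro X V h
    filter_upwards [h, target_mem_nhds hy] with z hz hzt
    rw [mpullback_apply, hz]
    exact chartFrame_inverse_apply hzt _
  rw [(e hX).mlieBracket_vectorField_eq (e hY)] at h
  have h1 := congrFun (mlieBracketWithin_eq_lieBracketWithin (𝕜 := ℝ) (V := V) (W := W)
    (s := Set.univ)) y
  rw [lieBracketWithin_univ] at h1
  have h2 : (chartFrame c y).inverse (RiemGeom.bracket X Y ((extChartAt (𝓡 n) c).symm y)) =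
    fderiv ℝ W y (V y) - fderiv ℝ V y (W y) := h.trans h1
  rw [← h2, chartFrame_apply_inverse hy]

end RiemGeom

/-! ### Connection, curvature and Lie derivatives in a chart -/

namespace RiemGeom

open Module Filter Topology LocalGeom VectorField

variable {n : ℕ} {M : Type*} [TopologicalSpace M] [ChartedSpace (EuclideanSpace ℝ (Fin n)) M]

/-- The two-tensor `h` has the coordinate expression `H` in the chart at `c`. -/
def TensorRep (c : M) (h : Tensor2 n M)
    (H : EuclideanSpace ℝ (Fin n) → Bil (EuclideanSpace ℝ (Fin n))) : Prop :=
  ∀ y ∈ (extChartAt (𝓡 n) c).target, ∀ a b,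
    h ((extChartAt (𝓡 n) c).symm y) (chartFrame c y a) (chartFrame c y b) = H y a b

variable [IsManifold (𝓡 n) ∞ M] {c : M} {y : EuclideanSpace ℝ (Fin n)}
  {h : Tensor2 n M} {H : EuclideanSpace ℝ (Fin n) → Bil (EuclideanSpace ℝ (Fin n))}

/-- Exhibiting w makes the choice in `dualVec` satisfy its specification; definiteness makes the
solution unique, so the choice is w. -/
theorem TensorRep.dualVec_eq (hh : TensorRep c h H) (hy : y ∈ (extChartAt (𝓡 n) c).target)
    (hi : IsInner (H y)) {α : TangentSpace (𝓡 n) ((extChartAt (𝓡 n) c).symm y) → ℝ}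
    {w : EuclideanSpace ℝ (Fin n)} (hw : ∀ b, H y w b = α (chartFrame c y b)) :
    dualVec h ((extChartAt (𝓡 n) c).symm y) α = chartFrame c y w := by
  have hex : ∃ w' : TangentSpace (𝓡 n) ((extChartAt (𝓡 n) c).symm y),
      ∀ v, h ((extChartAt (𝓡 n) c).symm y) w' v = α v := by
    refine ⟨chartFrame c y w, fun v => ?_⟩
    obtain ⟨b, rfl⟩ := chartFrame_surjective hy v
    rw [hh y hy, hw]
  have hspec := Classical.epsilon_spec hex
  obtain ⟨w', hw'⟩ := chartFrame_surjective hy (dualVec h ((extChartAt (𝓡 n) c).symm y) α)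
  rw [← hw']
  congr 1
  refine hi.eq_of_forall fun b => ?_
  rw [hw, ← hh y hy, hw']
  exact hspec _

omit [IsManifold (𝓡 n) ∞ M] in
theorem TensorRep.eventuallyEq (hh : TensorRep c h H) {Y Z : VField n M}
    {W V : EuclideanSpace ℝ (Fin n) → EuclideanSpace ℝ (Fin n)}
    (hY : Represents c Y W y) (hZ : Represents c Z V y)
    (hy : y ∈ (extChartAt (𝓡 n) c).target) :
    (fun z => h ((extChartAt (𝓡 n) c).symm z) (Y ((extChartAt (𝓡 n) c).symm z))
      (Z ((extChartAt (𝓡 n) c).symm z))) =ᶠ[𝓝 y] fun z => H z (W z) (V z) := by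
  filter_upwards [hY, hZ, target_mem_nhds hy] with z h1 h2 hz
  rw [h1, h2, hh z hz]

theorem TensorRep.dirDeriv_eq (hh : TensorRep c h H) {Y Z : VField n M}
    {W V : EuclideanSpace ℝ (Fin n) → EuclideanSpace ℝ (Fin n)}
    (hY : Represents c Y W y) (hZ : Represents c Z V y)
    (hy : y ∈ (extChartAt (𝓡 n) c).target) (hH : DifferentiableAt ℝ H y)
    (hW : DifferentiableAt ℝ W y) (hV : DifferentiableAt ℝ V y) (a : EuclideanSpace ℝ (Fin n)) :
    dirDeriv (fun x => h x (Y x) (Z x)) ((extChartAt (𝓡 n) c).symm y) (chartFrame c y a) =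
      fderiv ℝ H y a (W y) (V y) + H y (fderiv ℝ W y a) (V y) + H y (W y) (fderiv ℝ V y a) := by
  have he := hh.eventuallyEq hY hZ hy
  rw [dirDeriv_chartFrame hy, he.fderiv_eq, fderiv_apply₂ hH hW hV]
  refine DifferentiableAt.congr_of_eventuallyEq ?_ he
  exact (hH.clm_apply hW).clm_apply hV

/-- The coordinate expression of the Levi-Civita connection. -/
theorem TensorRep.leviCivita_eq (hh : TensorRep c h H)
    (hH : LocalMetric (extChartAt (𝓡 n) c).target H) {X Y : VField n M}
    {V W : EuclideanSpace ℝ (Fin n) → EuclideanSpace ℝ (Fin n)}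
    (hX : Represents c X V y) (hY : Represents c Y W y)
    (hy : y ∈ (extChartAt (𝓡 n) c).target)
    (hV : DifferentiableAt ℝ V y) (hW : DifferentiableAt ℝ W y) :
    leviCivita h X Y ((extChartAt (𝓡 n) c).symm y) =
      chartFrame c y (fderiv ℝ W y (V y) + christoffel H y (V y) (W y)) := by
  refine hh.dualVec_eq hy (hH.inner y hy) fun b => ?_
  obtain ⟨Z, hZ, hZr, hZy⟩ := exists_represents_ext hy b
  have dZ : DifferentiableAt ℝ Z y := hZ.differentiableAt (by simp)
  have dH := hH.differentiableAt hy
  have hs := (hH.inner y hy).symm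
  rw [koszul, hX.eq, hY.eq, hZr.eq, hh.dirDeriv_eq hY hZr hy dH hW dZ,
    hh.dirDeriv_eq hX hZr hy dH hV dZ, hh.dirDeriv_eq hX hY hy dH hV hW,
    hX.bracket hY hy hV hW, hX.bracket hZr hy hV dZ, hY.bracket hZr hy hW dZ,
    hh y hy, hh y hy, hh y hy, map_add, add_apply, hH.christoffel_spec hy, hZy]
  simp only [map_sub, sub_apply]
  rw [hs (fderiv ℝ W y b), hs (fderiv ℝ Z y (W y)), hs (fderiv ℝ Z y (V y))]
  ring

theorem TensorRep.leviCivita_represents (hh : TensorRep c h H)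
    (hH : LocalMetric (extChartAt (𝓡 n) c).target H) {X Y : VField n M}
    {V W : EuclideanSpace ℝ (Fin n) → EuclideanSpace ℝ (Fin n)}
    (hX : Represents c X V y) (hY : Represents c Y W y)
    (hy : y ∈ (extChartAt (𝓡 n) c).target)
    (hV : ContDiffAt ℝ ∞ V y) (hW : ContDiffAt ℝ ∞ W y) :
    Represents c (leviCivita h X Y)
      (fun z => fderiv ℝ W z (V z) + christoffel H z (V z) (W z)) y := by
  -- Smoothness at the point y already implies C¹ on a neighbourhood, so the pointwise formula holds
  -- at all nearby points.
  have ev : ∀ {V : EuclideanSpace ℝ (Fin n) → EuclideanSpace ℝ (Fin n)}, ContDiffAt ℝ ∞ V y →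
      ∀ᶠ z in 𝓝 y, DifferentiableAt ℝ V z := fun hV => by
    filter_upwards [(hV.of_le (m := 1) ENat.LEInfty.out).eventually (by simp)] with z hz
    exact hz.differentiableAt (by simp)
  filter_upwards [hX.eventually, hY.eventually, ev hV, ev hW, target_mem_nhds hy]
    with z h1 h2 h3 h4 hz
  exact hh.leviCivita_eq hH h1 h2 hz h3 h4

omit [IsManifold (𝓡 n) ∞ M] in
theorem contDiffAt_connection (hH : LocalMetric (extChartAt (𝓡 n) c).target H)
    {V W : EuclideanSpace ℝ (Fin n) → EuclideanSpace ℝ (Fin n)}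
    (hy : y ∈ (extChartAt (𝓡 n) c).target)
    (hV : ContDiffAt ℝ ∞ V y) (hW : ContDiffAt ℝ ∞ W y) :
    ContDiffAt ℝ ∞ (fun z => fderiv ℝ W z (V z) + christoffel H z (V z) (W z)) y :=
  ((contDiffAt_fderiv hW).clm_apply hV).add
    (((hH.contDiffAt_christoffel hy).clm_apply hV).clm_apply hW)

omit [IsManifold (𝓡 n) ∞ M] in
theorem fderiv_connection (hH : LocalMetric (extChartAt (𝓡 n) c).target H)
    {V W : EuclideanSpace ℝ (Fin n) → EuclideanSpace ℝ (Fin n)}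
    (hy : y ∈ (extChartAt (𝓡 n) c).target)
    (hV : ContDiffAt ℝ ∞ V y) (hW : ContDiffAt ℝ ∞ W y) (a : EuclideanSpace ℝ (Fin n)) :
    fderiv ℝ (fun z => fderiv ℝ W z (V z) + christoffel H z (V z) (W z)) y a =
      fderiv ℝ (fderiv ℝ W) y a (V y) + fderiv ℝ W y (fderiv ℝ V y a)
      + (fderiv ℝ (christoffel H) y a (V y) (W y) + christoffel H y (fderiv ℝ V y a) (W y)
        + christoffel H y (V y) (fderiv ℝ W y a)) := by
  have dV := hV.differentiableAt (by simp)
  have dW := hW.differentiableAt (by simp)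
  have ddW : DifferentiableAt ℝ (fderiv ℝ W) y := (contDiffAt_fderiv hW).differentiableAt (by simp)
  have dΓ := hH.differentiableAt_christoffel hy
  rw [fderiv_fun_add (by fun_prop) (by fun_prop), add_apply, fderiv_apply₁ ddW dV,
    fderiv_apply₂ dΓ dV dW]

theorem Represents.bracket_represents {X Y : VField n M}
    {V W : EuclideanSpace ℝ (Fin n) → EuclideanSpace ℝ (Fin n)}
    (hX : Represents c X V y) (hY : Represents c Y W y)
    (hy : y ∈ (extChartAt (𝓡 n) c).target)
    (hV : ContDiffAt ℝ ∞ V y) (hW : ContDiffAt ℝ ∞ W y) :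
    Represents c (RiemGeom.bracket X Y) (fun z => fderiv ℝ W z (V z) - fderiv ℝ V z (W z)) y := by
  have ev : ∀ {V : EuclideanSpace ℝ (Fin n) → EuclideanSpace ℝ (Fin n)}, ContDiffAt ℝ ∞ V y →
      ∀ᶠ z in 𝓝 y, DifferentiableAt ℝ V z := fun hV => by
    filter_upwards [(hV.of_le (m := 1) ENat.LEInfty.out).eventually (by simp)] with z hz
    exact hz.differentiableAt (by simp)
  filter_upwards [hX.eventually, hY.eventually, ev hV, ev hW, target_mem_nhds hy]
    with z h1 h2 h3 h4 hz
  exact h1.bracket h2 hz h3 h4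

theorem contDiffAt_bracket {V W : EuclideanSpace ℝ (Fin n) → EuclideanSpace ℝ (Fin n)}
    (hV : ContDiffAt ℝ ∞ V y) (hW : ContDiffAt ℝ ∞ W y) :
    ContDiffAt ℝ ∞ (fun z => fderiv ℝ W z (V z) - fderiv ℝ V z (W z)) y :=
  ((contDiffAt_fderiv hW).clm_apply hV).sub ((contDiffAt_fderiv hV).clm_apply hW)

theorem fderiv_bracket {V W : EuclideanSpace ℝ (Fin n) → EuclideanSpace ℝ (Fin n)}
    (hV : ContDiffAt ℝ ∞ V y) (hW : ContDiffAt ℝ ∞ W y) (a : EuclideanSpace ℝ (Fin n)) :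
    fderiv ℝ (fun z => fderiv ℝ W z (V z) - fderiv ℝ V z (W z)) y a =
      fderiv ℝ (fderiv ℝ W) y a (V y) + fderiv ℝ W y (fderiv ℝ V y a)
      - (fderiv ℝ (fderiv ℝ V) y a (W y) + fderiv ℝ V y (fderiv ℝ W y a)) := by
  have dV := hV.differentiableAt (by simp)
  have dW := hW.differentiableAt (by simp)
  have ddW : DifferentiableAt ℝ (fderiv ℝ W) y := (contDiffAt_fderiv hW).differentiableAt (by simp)
  have ddV : DifferentiableAt ℝ (fderiv ℝ V) y := (contDiffAt_fderiv hV).differentiableAt (by simp)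
  rw [fderiv_fun_sub (by fun_prop) (by fun_prop), sub_apply, fderiv_apply₁ ddW dV,
    fderiv_apply₁ ddV dW]

/-- The coordinate expression of the curvature. -/
theorem TensorRep.curvature_eq (hh : TensorRep c h H)
    (hH : LocalMetric (extChartAt (𝓡 n) c).target H) {X Y Z : VField n M}
    {V W U : EuclideanSpace ℝ (Fin n) → EuclideanSpace ℝ (Fin n)}
    (hX : Represents c X V y) (hY : Represents c Y W y) (hZ : Represents c Z U y)
    (hy : y ∈ (extChartAt (𝓡 n) c).target)
    (hV : ContDiffAt ℝ ∞ V y) (hW : ContDiffAt ℝ ∞ W y) (hU : ContDiffAt ℝ ∞ U y) :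
    curvature h X Y Z ((extChartAt (𝓡 n) c).symm y) =
      chartFrame c y (curv H y (V y) (W y) (U y)) := by
  have dV := hV.differentiableAt (by simp)
  have dW := hW.differentiableAt (by simp)
  have dU := hU.differentiableAt (by simp)
  have cYZ := contDiffAt_connection hH hy hW hU
  have cXZ := contDiffAt_connection hH hy hV hU
  rw [curvature, Pi.sub_apply, Pi.sub_apply,
    hh.leviCivita_eq hH hX (hh.leviCivita_represents hH hY hZ hy hW hU) hy dV
      (cYZ.differentiableAt (by simp)),
    hh.leviCivita_eq hH hY (hh.leviCivita_represents hH hX hZ hy hV hU) hy dW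
      (cXZ.differentiableAt (by simp)),
    hh.leviCivita_eq hH (hX.bracket_represents hY hy hV hW) hZ hy
      ((contDiffAt_bracket hV hW).differentiableAt (by simp)) dU,
    ← map_sub, ← map_sub, fderiv_connection hH hy hW hU, fderiv_connection hH hy hV hU]
  -- The terms with derivatives of V and W cancel against the bracket term, and the second
  -- derivatives of U cancel by symmetry: curvature is tensorial.
  congr 1
  simp only [curv_apply, map_add, map_sub, sub_apply, fderiv_fderiv_symm hU (V y) (W y)]
  abel

/-- The coordinate expression of the covariant derivative of a two-tensor. -/
theorem TensorRep.covDeriv_eq (hh : TensorRep c h H)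
    (hH : LocalMetric (extChartAt (𝓡 n) c).target H) {k : Tensor2 n M}
    {K : EuclideanSpace ℝ (Fin n) → Bil (EuclideanSpace ℝ (Fin n))} (hk : TensorRep c k K)
    (hy : y ∈ (extChartAt (𝓡 n) c).target) (hK : DifferentiableAt ℝ K y)
    (u v w : EuclideanSpace ℝ (Fin n)) :
    covDeriv h k ((extChartAt (𝓡 n) c).symm y) (chartFrame c y u) (chartFrame c y v)
      (chartFrame c y w) = nablaBil H K y u v w := by
  obtain ⟨U, hU, rU, eU⟩ := exists_represents_ext hy u
  obtain ⟨V, hV, rV, eV⟩ := exists_represents_ext hy v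
  obtain ⟨W, hW, rW, eW⟩ := exists_represents_ext hy w
  have dU := hU.differentiableAt (by simp)
  have dV := hV.differentiableAt (by simp)
  have dW := hW.differentiableAt (by simp)
  rw [covDeriv, hk.dirDeriv_eq rV rW hy hK dV dW, hh.leviCivita_eq hH rU rV hy dU dV,
    hh.leviCivita_eq hH rU rW hy dU dW, hk y hy, hk y hy, nablaBil, eU, eV, eW]
  simp only [map_add, add_apply]
  ring

/-- The coordinate expression of the Lie derivative of a two-tensor. -/
theorem TensorRep.lieDeriv (hh : TensorRep c h H) {ξ : VField n M}
    {X : EuclideanSpace ℝ (Fin n) → EuclideanSpace ℝ (Fin n)}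
    (hξ : ∀ y ∈ (extChartAt (𝓡 n) c).target, Represents c ξ X y)
    (hX : DifferentiableOn ℝ X (extChartAt (𝓡 n) c).target)
    (hH : DifferentiableOn ℝ H (extChartAt (𝓡 n) c).target) :
    TensorRep c (lieDeriv ξ h) (lieBil X H) := by
  intro y hy v w
  obtain ⟨V, hV, rV, eV⟩ := exists_represents_ext hy v
  obtain ⟨W, hW, rW, eW⟩ := exists_represents_ext hy w
  have dV := hV.differentiableAt (by simp)
  have dW := hW.differentiableAt (by simp)
  have dX := hX.differentiableAt (target_mem_nhds hy)
  rw [RiemGeom.lieDeriv, (hξ y hy).eq,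
    hh.dirDeriv_eq rV rW hy (hH.differentiableAt (target_mem_nhds hy)) dV dW,
    (hξ y hy).bracket rV hy dX dV, (hξ y hy).bracket rW hy dX dW, hh y hy, hh y hy, lieBil_apply,
    eV, eW]
  simp only [map_sub, sub_apply]
  ring

/-- The coordinate expression of the Lie derivative of the Levi-Civita connection. -/
theorem TensorRep.lieDerivConnection_eq (hh : TensorRep c h H)
    (hH : LocalMetric (extChartAt (𝓡 n) c).target H) {ξ : VField n M}
    {X : EuclideanSpace ℝ (Fin n) → EuclideanSpace ℝ (Fin n)}
    (hξ : Represents c ξ X y) (hX : ContDiffAt ℝ ∞ X y)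
    (hy : y ∈ (extChartAt (𝓡 n) c).target) (v w : EuclideanSpace ℝ (Fin n)) :
    lieDerivConnection h ξ ((extChartAt (𝓡 n) c).symm y) (chartFrame c y v) (chartFrame c y w) =
      chartFrame c y (lieConn (christoffel H) X y v w) := by
  obtain ⟨V, hV, rV, eV⟩ := exists_represents_ext hy v
  obtain ⟨W, hW, rW, eW⟩ := exists_represents_ext hy w
  have dV := hV.differentiableAt (by simp)
  have dW := hW.differentiableAt (by simp)
  have dX := hX.differentiableAt (by simp)
  rw [lieDerivConnection,
    hξ.bracket (hh.leviCivita_represents hH rV rW hy hV hW) hy dX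
      ((contDiffAt_connection hH hy hV hW).differentiableAt (by simp)),
    hh.leviCivita_eq hH (hξ.bracket_represents rV hy hX hV) rW hy
      ((contDiffAt_bracket hX hV).differentiableAt (by simp)) dW,
    hh.leviCivita_eq hH rV (hξ.bracket_represents rW hy hX hW) hy dV
      ((contDiffAt_bracket hX hW).differentiableAt (by simp)),
    ← map_sub, ← map_sub, fderiv_connection hH hy hV hW, fderiv_bracket hX hW]
  -- All derivatives of the extensions V and W cancel, which is the tensoriality of L_ξ∇; only their
  -- values v and w survive.
  congr 1
  simp only [lieConn, map_add, map_sub, sub_apply, fderiv_fderiv_symm hW (X y) v,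
    eV, eW]
  abel

end RiemGeom

/-! ### Coordinate expressions of the metric, Ricci tensor and divergence; harmonicity of the
identity -/

namespace RiemGeom

open Module Filter Topology LocalGeom VectorField

variable {n : ℕ} {M : Type*} [TopologicalSpace M] [ChartedSpace (EuclideanSpace ℝ (Fin n)) M]

/-- The coordinate expression of a field of bilinear forms. -/
noncomputable def chartBil (c : M) (φ : BilinForm n M) (y : EuclideanSpace ℝ (Fin n)) :
    Bil (EuclideanSpace ℝ (Fin n)) :=
  LinearMap.toContinuousLinearMap
    ((LinearMap.toContinuousLinearMap (𝕜 := ℝ) (E := EuclideanSpace ℝ (Fin n)) (F' := ℝ)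
      : _ →ₗ[ℝ] _).comp
      (LinearMap.mk₂ ℝ (fun a b => φ ((extChartAt (𝓡 n) c).symm y) (chartFrame c y a)
        (chartFrame c y b)) (by intros; simp only [map_add, add_apply])
        (by intros; simp only [map_smul, smul_apply]) (by intros; simp only [map_add])
        (by intros; simp only [map_smul])))

@[simp] theorem chartBil_apply (c : M) (φ : BilinForm n M) (y a b : EuclideanSpace ℝ (Fin n)) :
    chartBil c φ y a b =
      φ ((extChartAt (𝓡 n) c).symm y) (chartFrame c y a) (chartFrame c y b) := rfl

theorem tensorRep_chartBil (c : M) (φ : BilinForm n M) :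
    TensorRep c φ.toTensor2 (chartBil c φ) := fun _ _ _ _ => rfl

/-- The coordinate expression of a one-form. -/
noncomputable def chartForm (c : M) (θ : OneForm n M) (y : EuclideanSpace ℝ (Fin n)) :
    EuclideanSpace ℝ (Fin n) →L[ℝ] ℝ :=
  (θ ((extChartAt (𝓡 n) c).symm y)).comp (chartFrame c y)

@[simp] theorem chartForm_apply (c : M) (θ : OneForm n M) (y a : EuclideanSpace ℝ (Fin n)) :
    chartForm c θ y a = θ ((extChartAt (𝓡 n) c).symm y) (chartFrame c y a) := rfl

variable [IsManifold (𝓡 n) ∞ M] {c : M} {y : EuclideanSpace ℝ (Fin n)}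

/-- The coordinate field with constant components a is the pullback of a constant field by the
chart. Evaluating a smooth tensor on such fields gives smooth components. -/
theorem contMDiffOn_chartFrame (c : M) (a : EuclideanSpace ℝ (Fin n)) :
    ContMDiffOn 𝓘(ℝ, EuclideanSpace ℝ (Fin n)) (𝓡 n).tangent ∞
      (fun z => TotalSpace.mk' (EuclideanSpace ℝ (Fin n)) (E := fun x : M => TangentSpace (𝓡 n) x)
        ((extChartAt (𝓡 n) c).symm z) (chartFrame c z a)) (extChartAt (𝓡 n) c).target := by
  have : IsManifold (𝓡 n) 1 M := IsManifold.of_le (n := ∞) ENat.LEInfty.out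
  intro y hy
  refine ContMDiffAt.contMDiffWithinAt ?_
  let V : Π z : EuclideanSpace ℝ (Fin n), TangentSpace 𝓘(ℝ, EuclideanSpace ℝ (Fin n)) z :=
    fun _ => a
  have hV : ContMDiffAt 𝓘(ℝ, EuclideanSpace ℝ (Fin n)) 𝓘(ℝ, EuclideanSpace ℝ (Fin n)).tangent ∞
      (fun z => TotalSpace.mk' (EuclideanSpace ℝ (Fin n)) z (V z))
      (extChartAt (𝓡 n) c ((extChartAt (𝓡 n) c).symm y)) :=
    contMDiffAt_vectorSpace_iff_contDiffAt.2 contDiffAt_const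
  have h1 := ContMDiffAt.mpullback_vectorField_preimage (n := ∞) hV (contMDiffAt_chart hy)
    (isInvertible_mfderiv_extChartAt ((extChartAt (𝓡 n) c).map_target hy)) (by simp)
  refine (h1.comp y (contMDiffAt_symm hy)).congr_of_eventuallyEq ?_
  filter_upwards [target_mem_nhds hy] with z hz
  rw [Function.comp_apply, mpullback_chart hz]

theorem contDiffOn_chartBil (c : M) {φ : BilinForm n M} (hφ : IsSmoothBilinForm φ) :
    ContDiffOn ℝ ∞ (chartBil c φ) (extChartAt (𝓡 n) c).target := by
  refine contDiffOn_clm_apply.2 fun a => contDiffOn_clm_apply.2 fun b => ?_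
  rw [← contMDiffOn_iff_contDiffOn]
  have h := ContMDiffOn.clm_bundle_apply₂ (M := EuclideanSpace ℝ (Fin n))
    (IM := 𝓘(ℝ, EuclideanSpace ℝ (Fin n))) (F₃ := ℝ) (E₃ := Trivial M ℝ)
    (b := (extChartAt (𝓡 n) c).symm) (ψ := fun z => φ ((extChartAt (𝓡 n) c).symm z)) (hφ.comp_contMDiffOn (contMDiffOn_extChartAt_symm c))
    (contMDiffOn_chartFrame c a) (contMDiffOn_chartFrame c b)
  intro z hz
  have := h z hz
  rw [contMDiffWithinAt_totalSpace] at this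
  simpa using this.2

theorem contDiffOn_chartForm (c : M) {θ : OneForm n M} (hθ : IsSmoothOneForm θ) :
    ContDiffOn ℝ ∞ (chartForm c θ) (extChartAt (𝓡 n) c).target := by
  refine contDiffOn_clm_apply.2 fun a => ?_
  rw [← contMDiffOn_iff_contDiffOn]
  have h := ContMDiffOn.clm_bundle_apply (M := EuclideanSpace ℝ (Fin n))
    (IM := 𝓘(ℝ, EuclideanSpace ℝ (Fin n))) (F₂ := ℝ) (E₂ := Trivial M ℝ)
    (b := (extChartAt (𝓡 n) c).symm) (ϕ := fun z => θ ((extChartAt (𝓡 n) c).symm z)) (hθ.comp_contMDiffOn (contMDiffOn_extChartAt_symm c))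
    (contMDiffOn_chartFrame c a)
  intro z hz
  have := h z hz
  rw [contMDiffWithinAt_totalSpace] at this
  simpa using this.2

/-- The coordinate expression of a Riemannian metric. -/
noncomputable def chartMetric (g : Metric n M) (c : M) :
    EuclideanSpace ℝ (Fin n) → Bil (EuclideanSpace ℝ (Fin n)) := chartBil c g.inner

theorem tensorRep_chartMetric (g : Metric n M) (c : M) :
    TensorRep c g.tensor (chartMetric g c) := fun _ _ _ _ => rfl

theorem localMetric_chartMetric (g : Metric n M) (c : M) :
    LocalMetric (extChartAt (𝓡 n) c).target (chartMetric g c) where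
  isOpen := isOpen_extChartAt_target c
  smooth := contDiffOn_chartBil c g.contMDiff
  inner y hy :=
    { symm := fun _ _ => g.symm _ _ _
      pos := fun _ hv => g.pos _ _ fun h0 => hv (chartFrame_injective hy (h0.trans
        (map_zero (chartFrame c y)).symm)) }

/-- The coordinate expression of the vector field dual to a one-form. -/
noncomputable def chartSharp (g : Metric n M) (θ : OneForm n M) (c : M)
    (y : EuclideanSpace ℝ (Fin n)) : EuclideanSpace ℝ (Fin n) :=
  (chartMetric g c y).inverse (chartForm c θ y)

theorem contDiffOn_chartSharp (g : Metric n M) {θ : OneForm n M} (hθ : IsSmoothOneForm θ) (c : M) :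
    ContDiffOn ℝ ∞ (chartSharp g θ c) (extChartAt (𝓡 n) c).target :=
  (localMetric_chartMetric g c).contDiffOn_inverse.clm_apply (contDiffOn_chartForm c hθ)

theorem sharp_eq (g : Metric n M) (θ : OneForm n M)
    (hy : y ∈ (extChartAt (𝓡 n) c).target) :
    sharp g.tensor θ ((extChartAt (𝓡 n) c).symm y) = chartFrame c y (chartSharp g θ c y) :=
  (tensorRep_chartMetric g c).dualVec_eq hy ((localMetric_chartMetric g c).inner y hy) fun _ =>
    ((localMetric_chartMetric g c).inner y hy).inverse_apply _ _

theorem represents_sharp (g : Metric n M) (θ : OneForm n M)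
    (hy : y ∈ (extChartAt (𝓡 n) c).target) :
    Represents c (sharp g.tensor θ) (chartSharp g θ c) y := by
  filter_upwards [target_mem_nhds hy] with z hz using sharp_eq g θ hz

theorem tensorRep_deltaStar (g : Metric n M) {θ : OneForm n M} (hθ : IsSmoothOneForm θ) (c : M)
    (hy : y ∈ (extChartAt (𝓡 n) c).target) (a b : EuclideanSpace ℝ (Fin n)) :
    deltaStar g.tensor θ ((extChartAt (𝓡 n) c).symm y) (chartFrame c y a) (chartFrame c y b) =
      (1 / 2) * lieBil (chartSharp g θ c) (chartMetric g c) y a b := by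
  rw [deltaStar, (tensorRep_chartMetric g c).lieDeriv (fun y hy => represents_sharp g θ hy)
    ((contDiffOn_chartSharp g hθ c).differentiableOn (by simp))
    ((localMetric_chartMetric g c).smooth.differentiableOn (by simp)) y hy]

/-- An orthonormal frame exists in coordinates, so the frame chosen by `orthoFrame` really is
orthonormal; it is then pulled back to coordinates. -/
theorem exists_orthoFrame (g : Metric n M) (hy : y ∈ (extChartAt (𝓡 n) c).target) :
    ∃ e : Fin n → EuclideanSpace ℝ (Fin n), IsFrame (chartMetric g c y) e ∧
      ∀ i, orthoFrame g.tensor ((extChartAt (𝓡 n) c).symm y) i = chartFrame c y (e i) := by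
  have hrep := tensorRep_chartMetric g c y hy
  obtain ⟨e₀, he₀⟩ := ((localMetric_chartMetric g c).inner y hy).exists_frame (n := n) (by simp)
  have hspec : IsOrthonormalFrame g.tensor ((extChartAt (𝓡 n) c).symm y)
      (orthoFrame g.tensor ((extChartAt (𝓡 n) c).symm y)) :=
    Classical.epsilon_spec ⟨fun i => chartFrame c y (e₀ i), fun i j => by rw [hrep, he₀]⟩
  choose e he using fun i =>
    chartFrame_surjective hy (orthoFrame g.tensor ((extChartAt (𝓡 n) c).symm y) i)
  refine ⟨e, fun i j => ?_, fun i => (he i).symm⟩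
  rw [← hrep, he, he, hspec i j]

/-- The metric trace in coordinates. -/
theorem traceAt_eq (g : Metric n M) (hy : y ∈ (extChartAt (𝓡 n) c).target)
    {B : TangentSpace (𝓡 n) ((extChartAt (𝓡 n) c).symm y) →
      TangentSpace (𝓡 n) ((extChartAt (𝓡 n) c).symm y) → ℝ}
    {K : Bil (EuclideanSpace ℝ (Fin n))}
    (hB : ∀ a b, B (chartFrame c y a) (chartFrame c y b) = K a b) :
    traceAt g.tensor ((extChartAt (𝓡 n) c).symm y) B = trBil (chartMetric g c y) K := by
  obtain ⟨e, he, hf⟩ := exists_orthoFrame g hy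
  rw [((localMetric_chartMetric g c).inner y hy).trBil_eq he (by simp), traceAt]
  exact Finset.sum_congr rfl fun i _ => by rw [hf, hB]

/-- The Ricci tensor in coordinates. -/
theorem tensorRep_ricci (g : Metric n M) (c : M) :
    TensorRep c (ricci g.tensor) (ric (chartMetric g c)) := by
  intro y hy a b
  obtain ⟨e, he, hf⟩ := exists_orthoFrame g hy
  obtain ⟨A, hA, rA, eA⟩ := exists_represents_ext hy a
  obtain ⟨B, hB, rB, eB⟩ := exists_represents_ext hy b
  rw [he.ric_eq (by simp), ricci, traceAt]
  refine Finset.sum_congr rfl fun i _ => ?_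
  obtain ⟨U, hU, rU, eU⟩ := exists_represents_ext hy (e i)
  rw [hf, (tensorRep_chartMetric g c).curvature_eq (localMetric_chartMetric g c) rU rA rB hy
    hU hA hB, tensorRep_chartMetric g c y hy, eU, eA, eB]

theorem scalarCurvature_eq (g : Metric n M) (hy : y ∈ (extChartAt (𝓡 n) c).target) :
    scalarCurvature g.tensor ((extChartAt (𝓡 n) c).symm y) =
      trBil (chartMetric g c y) (ric (chartMetric g c) y) :=
  traceAt_eq g hy (tensorRep_ricci g c y hy)

theorem divergence_eq (g : Metric n M) {φ : BilinForm n M} (hφ : IsSmoothBilinForm φ)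
    (hy : y ∈ (extChartAt (𝓡 n) c).target) {e : Fin n → EuclideanSpace ℝ (Fin n)}
    (he : ∀ i, orthoFrame g.tensor ((extChartAt (𝓡 n) c).symm y) i = chartFrame c y (e i))
    (z : EuclideanSpace ℝ (Fin n)) :
    divergence g.tensor φ.toTensor2 ((extChartAt (𝓡 n) c).symm y) (chartFrame c y z) =
      - ∑ i, nablaBil (chartMetric g c) (chartBil c φ) y (e i) (e i) z := by
  rw [divergence, traceAt]
  congr 1
  refine Finset.sum_congr rfl fun i _ => ?_
  rw [he, (tensorRep_chartMetric g c).covDeriv_eq (localMetric_chartMetric g c)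
    (tensorRep_chartBil c φ) hy
    (((contDiffOn_chartBil c hφ).differentiableOn (by simp)).differentiableAt (target_mem_nhds hy))]

-- Tangent spaces depend on the point, so statements are first proved at points of the form
-- `(extChartAt (𝓡 n) c).symm y` and then rewritten to x along this equality.
omit [IsManifold (𝓡 n) ∞ M] in
theorem exists_chart_eq (x : M) :
    ∃ y ∈ (extChartAt (𝓡 n) x).target, (extChartAt (𝓡 n) x).symm y = x :=
  ⟨_, mem_extChartAt_target x, extChartAt_to_inv x⟩

/-- If the Ricci tensor is a Riemannian metric, the identity map into it is harmonic. -/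
theorem isHarmonicId_ricci (g : Metric n M)
    (hpos : ∀ (x : M) (v : TangentSpace (𝓡 n) x), v ≠ 0 → 0 < ricci g.tensor x v v)
    (hsymm : ∀ (x : M) (v w : TangentSpace (𝓡 n) x), ricci g.tensor x v w = ricci g.tensor x w v) :
    IsHarmonicId g.tensor (ricci g.tensor) := by
  have main : ∀ (c : M) (y : EuclideanSpace ℝ (Fin n)), y ∈ (extChartAt (𝓡 n) c).target →
      traceAt g.tensor ((extChartAt (𝓡 n) c).symm y) (secondFundamentalFormId g.tensor
        (ricci g.tensor) ((extChartAt (𝓡 n) c).symm y)) = 0 := by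
    intro c y hy
    have hG := localMetric_chartMetric g c
    have hrep := tensorRep_ricci g c
    have hR : LocalMetric (extChartAt (𝓡 n) c).target (ric (chartMetric g c)) :=
      { isOpen := hG.isOpen
        smooth := hG.contDiffOn_ric
        inner := fun z hz =>
          { symm := fun v w => by rw [← hrep z hz, ← hrep z hz, hsymm]
            pos := fun v hv => by
              rw [← hrep z hz]
              exact hpos _ _ fun h0 => hv (chartFrame_injective hz (h0.trans
                (map_zero (chartFrame c z)).symm)) } }
    obtain ⟨e, he, hf⟩ := exists_orthoFrame g hy
    rw [traceAt, ← map_zero (chartFrame c y), ← hG.tension_ric_eq_zero hR hy (by simp) he, map_sum]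
    refine Finset.sum_congr rfl fun i _ => ?_
    -- Both connections act on the same extension U of e_i, so the derivative of U drops out of the
    -- difference and only Christoffel symbols remain.
    obtain ⟨U, hU, rU, eU⟩ := exists_represents_ext hy (e i)
    have dU := hU.differentiableAt (by simp)
    rw [secondFundamentalFormId, hf, hrep.leviCivita_eq hR rU rU hy dU dU,
      (tensorRep_chartMetric g c).leviCivita_eq hG rU rU hy dU dU, ← map_sub, eU]
    congr 1
    abel
  intro x
  obtain ⟨y, hy, hx⟩ := exists_chart_eq (n := n) x
  have := main x y hy
  rwa [hx] at this

end RiemGeom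

/-! ### Consequences of the York decomposition on M -/

namespace RiemGeom

open Module Filter Topology LocalGeom VectorField

variable {n : ℕ} {M : Type*} [TopologicalSpace M] [ChartedSpace (EuclideanSpace ℝ (Fin n)) M]
  [IsManifold (𝓡 n) ∞ M] {c : M} {y : EuclideanSpace ℝ (Fin n)}

/-- The data of a York decomposition of the Ricci tensor. -/
structure IsYork (g : Metric n M) (θ : OneForm n M) (lam : M → ℝ) (φ : BilinForm n M) : Prop where
  smooth_form : IsSmoothOneForm θ
  smooth_lam : ContMDiff (𝓡 n) 𝓘(ℝ, ℝ) ∞ lam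
  tt : IsTT g.tensor φ
  eq : ∀ (x : M) (v w : TangentSpace (𝓡 n) x), ricci g.tensor x v w =
    (deltaStar g.tensor θ x v w + lam x * g.tensor x v w) + φ x v w

variable {g : Metric n M} {θ : OneForm n M} {lam : M → ℝ} {φ : BilinForm n M}

theorem deltaStar_symm (g : Metric n M) (θ : OneForm n M) (x : M) (v w : TangentSpace (𝓡 n) x) :
    deltaStar g.tensor θ x v w = deltaStar g.tensor θ x w v := by
  have hs : ∀ (x : M) (v w : TangentSpace (𝓡 n) x), g.tensor x v w = g.tensor x w v := g.symm
  have h1 : (fun y => g.tensor y (ext v y) (ext w y)) = fun y => g.tensor y (ext w y) (ext v y) :=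
    funext fun y => hs y _ _
  rw [deltaStar, deltaStar, lieDeriv, lieDeriv, h1, hs x v, hs x _ w]
  ring

/-- Each summand of the decomposition is symmetric, so the symmetry of Ric is read off without the
first Bianchi identity. -/
theorem IsYork.ricci_symm (h : IsYork g θ lam φ) (x : M) (v w : TangentSpace (𝓡 n) x) :
    ricci g.tensor x v w = ricci g.tensor x w v := by
  have hs : ∀ (x : M) (v w : TangentSpace (𝓡 n) x), g.tensor x v w = g.tensor x w v := g.symm
  rw [h.eq, h.eq, deltaStar_symm, hs x v w, h.tt.symm x v w]

theorem IsYork.chart_eq (h : IsYork g θ lam φ) (hy : y ∈ (extChartAt (𝓡 n) c).target)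
    (v w : EuclideanSpace ℝ (Fin n)) :
    ric (chartMetric g c) y v w =
      (1 / 2) * lieBil (chartSharp g θ c) (chartMetric g c) y v w
        + lam ((extChartAt (𝓡 n) c).symm y) * chartMetric g c y v w + chartBil c φ y v w := by
  rw [← tensorRep_ricci g c y hy, h.eq, tensorRep_deltaStar g h.smooth_form c hy,
    tensorRep_chartMetric g c y hy, chartBil_apply]

theorem IsYork.trBil_eq_zero (h : IsYork g θ lam φ) (hy : y ∈ (extChartAt (𝓡 n) c).target) :
    trBil (chartMetric g c y) (chartBil c φ y) = 0 := by
  rw [← h.tt.trace_eq_zero ((extChartAt (𝓡 n) c).symm y)]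
  exact (traceAt_eq g hy (tensorRep_chartBil c φ y hy)).symm

theorem contDiffOn_comp_symm {f : M → ℝ}
    (hf : ContMDiff (𝓡 n) 𝓘(ℝ, ℝ) ∞ f) (c : M) :
    ContDiffOn ℝ ∞ (fun y => f ((extChartAt (𝓡 n) c).symm y)) (extChartAt (𝓡 n) c).target := by
  rw [← contMDiffOn_iff_contDiffOn]
  exact hf.comp_contMDiffOn (contMDiffOn_extChartAt_symm c)

theorem IsYork.fderiv_lam_eq_zero (h : IsYork g θ lam φ) (h3 : 3 ≤ n)
    (hξ : IsInfinitesimalHarmonic g.tensor (sharp g.tensor θ))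
    (hy : y ∈ (extChartAt (𝓡 n) c).target) :
    fderiv ℝ (fun y => lam ((extChartAt (𝓡 n) c).symm y)) y = 0 := by
  obtain ⟨e, he, hf⟩ := exists_orthoFrame g hy
  have hG := localMetric_chartMetric g c
  have hX := contDiffOn_chartSharp g h.smooth_form c
  refine hG.fderiv_eq_zero_of_york hX (contDiffOn_comp_symm h.smooth_lam c)
    (contDiffOn_chartBil c h.tt.smooth) (fun z hz v w => ?_) (fun z hz => h.chart_eq hz)
    (fun z hz => h.trBil_eq_zero hz) hy (by simp) h3 he (fun z => ?_) ?_
  · rw [← tensorRep_ricci g c z hz, ← tensorRep_ricci g c z hz, h.ricci_symm]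
  · have h1 := h.tt.divergence_eq_zero ((extChartAt (𝓡 n) c).symm y) (chartFrame c y z)
    rw [divergence_eq g h.tt.smooth hy hf] at h1
    linarith
  · have h1 := hξ ((extChartAt (𝓡 n) c).symm y)
    refine chartFrame_injective hy ?_
    rw [map_zero (chartFrame c y), ← h1, traceAt, map_sum]
    refine Finset.sum_congr rfl fun i _ => ?_
    rw [hf, (tensorRep_chartMetric g c).lieDerivConnection_eq hG (represents_sharp g θ hy)
      (hX.contDiffAt (target_mem_nhds hy)) hy]

/-- The differential of λ vanishes on a coordinate ball around each point, so λ is locally constant,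
hence constant on the connected M. -/
theorem IsYork.exists_eq_const [ConnectedSpace M] (h : IsYork g θ lam φ) (h3 : 3 ≤ n)
    (hξ : IsInfinitesimalHarmonic g.tensor (sharp g.tensor θ)) : ∃ k, ∀ x, lam x = k := by
  have hloc : IsLocallyConstant lam := by
    rw [IsLocallyConstant.iff_eventually_eq]
    intro x
    obtain ⟨r, hr, hball⟩ := Metric.isOpen_iff.1 (isOpen_extChartAt_target (I := 𝓡 n) x) _
      (mem_extChartAt_target x)
    have hcont : ContinuousAt (extChartAt (𝓡 n) x) x := continuousAt_extChartAt x
    filter_upwards [hcont.preimage_mem_nhds (Metric.ball_mem_nhds _ hr),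
      extChartAt_source_mem_nhds (I := 𝓡 n) x] with z hz hzs
    have hc := Metric.isOpen_ball.is_const_of_fderiv_eq_zero (𝕜 := ℝ)
      (f := fun y => lam ((extChartAt (𝓡 n) x).symm y))
      (Metric.isPreconnected_ball)
      (((contDiffOn_comp_symm h.smooth_lam x).differentiableOn (by simp)).mono hball)
      (fun y hy => h.fderiv_lam_eq_zero h3 hξ (hball hy)) hz (Metric.mem_ball_self hr)
    simpa only [(extChartAt (𝓡 n) x).left_inv hzs, extChartAt_to_inv x] using hc
  obtain ⟨x₀⟩ : Nonempty M := inferInstance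
  exact ⟨lam x₀, fun x => hloc.apply_eq_of_preconnectedSpace x x₀⟩

/-- The scalar curvature in terms of a York decomposition. -/
theorem IsYork.scalarCurvature_eq (h : IsYork g θ lam φ) (x : M) :
    scalarCurvature g.tensor x = traceAt g.tensor x (deltaStar g.tensor θ x) + n * lam x := by
  have main : ∀ (c : M) (y : EuclideanSpace ℝ (Fin n)), y ∈ (extChartAt (𝓡 n) c).target →
      scalarCurvature g.tensor ((extChartAt (𝓡 n) c).symm y) =
        traceAt g.tensor ((extChartAt (𝓡 n) c).symm y)
          (deltaStar g.tensor θ ((extChartAt (𝓡 n) c).symm y))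
        + n * lam ((extChartAt (𝓡 n) c).symm y) := by
    intro c y hy
    rw [RiemGeom.scalarCurvature_eq g hy,
      (localMetric_chartMetric g c).trBil_york (n := n) hy (by simp) (h.chart_eq hy) (h.trBil_eq_zero hy),
      traceAt_eq g (K := (1 / 2 : ℝ) • lieBil (chartSharp g θ c) (chartMetric g c) y) hy
        (fun a b => by rw [tensorRep_deltaStar g h.smooth_form c hy]; simp)]
    simp [trBil]
  obtain ⟨y, hy, hx⟩ := exists_chart_eq (n := n) x
  have := main x y hy
  rwa [hx] at this

end RiemGeom

/-! ### Determinants, the Riemannian density and its derivative -/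

namespace LocalGeom

open Module Filter Topology
open scoped Matrix

section Det

variable {n : ℕ}

/-- Jacobi's formula for the derivative of the determinant. -/
theorem differentiableAt_det_and_fderiv {A : Fin n → Fin n → ℝ} (hA : IsUnit (Matrix.of A).det) :
    DifferentiableAt ℝ (fun B : Fin n → Fin n → ℝ => (Matrix.of B).det) A ∧
      ∀ B, fderiv ℝ (fun B : Fin n → Fin n → ℝ => (Matrix.of B).det) A B =
        (Matrix.of A).det * ((Matrix.of A)⁻¹ * Matrix.of B).trace := by
  have hd : DifferentiableAt ℝ (fun B : Fin n → Fin n → ℝ => (Matrix.of B).det) A := by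
    simp only [Matrix.det_apply, Matrix.of_apply, Units.smul_def, zsmul_eq_mul]
    fun_prop
  refine ⟨hd, fun B => ?_⟩
  have h1 : HasDerivAt (fun t : ℝ => A + t • B) B 0 := by
    simpa using ((hasDerivAt_id (0 : ℝ)).smul_const B).const_add A
  have h2 : HasDerivAt (fun t : ℝ => (Matrix.of (A + t • B)).det)
      (fderiv ℝ (fun B : Fin n → Fin n → ℝ => (Matrix.of B).det) A B) 0 := by
    have h3 : HasFDerivAt (fun B : Fin n → Fin n → ℝ => (Matrix.of B).det)
        (fderiv ℝ (fun B : Fin n → Fin n → ℝ => (Matrix.of B).det) A) (A + (0 : ℝ) • B) := by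
      simpa using hd.hasFDerivAt
    exact h3.comp_hasDerivAt 0 h1
  set C : Matrix (Fin n) (Fin n) ℝ := (Matrix.of A)⁻¹ * Matrix.of B with hC
  -- Factoring out A reduces the derivative along the line A + tB to that of det(1 + tC) = 1 + t tr
  -- C + t² p(t) at t = 0.
  have h4 : ∀ t : ℝ, (Matrix.of (A + t • B)).det = (Matrix.of A).det * (1 + t • C).det := by
    intro t
    rw [← Matrix.det_mul, mul_add, mul_one, Matrix.mul_smul, hC, ← Matrix.mul_assoc,
      Matrix.mul_nonsing_inv _ hA, Matrix.one_mul]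
    rfl
  have h5 : HasDerivAt (fun t : ℝ => (1 + t • C).det) C.trace 0 := by
    rw [funext fun t : ℝ => Matrix.det_one_add_smul t C]
    set p := Polynomial.divX (Polynomial.divX
      (Matrix.det (1 + (Polynomial.X : Polynomial ℝ) • C.map Polynomial.C))) with hp
    have h6 : HasDerivAt (fun t : ℝ => p.eval t * t ^ 2) 0 0 := by
      simpa using (p.hasDerivAt 0).fun_mul (hasDerivAt_pow 2 (0 : ℝ))
    simpa using (((hasDerivAt_id (0 : ℝ)).const_mul C.trace).const_add 1).fun_add h6
  have h7 := h5.const_mul (Matrix.of A).det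
  simp only [← h4] at h7
  exact h2.unique h7

end Det

variable {n : ℕ}

/-- The Gram matrix of a bilinear form in the standard basis. -/
noncomputable def gram (B : Bil (EuclideanSpace ℝ (Fin n))) (i j : Fin n) : ℝ :=
  B (EuclideanSpace.single i 1) (EuclideanSpace.single j 1)

theorem apply_eq_sum_gram (B : Bil (EuclideanSpace ℝ (Fin n))) (v w : EuclideanSpace ℝ (Fin n)) :
    B v w = ∑ i, ∑ j, v i * w j * gram B i j := by
  have hv : ∀ v : EuclideanSpace ℝ (Fin n), v = ∑ i, v i • EuclideanSpace.single i (1 : ℝ) := by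
    intro v
    ext k
    simp [Finset.sum_apply, Pi.single_apply]
  conv_lhs => rw [hv v, hv w]
  simp only [map_sum, map_smul, sum_apply, smul_apply, smul_eq_mul, gram, Finset.mul_sum]
  rw [Finset.sum_comm]
  refine Finset.sum_congr rfl fun i _ => Finset.sum_congr rfl fun j _ => ?_
  ring

theorem IsInner.det_gram_pos {B : Bil (EuclideanSpace ℝ (Fin n))} (hB : IsInner B) :
    0 < (Matrix.of (gram B)).det := by
  refine Matrix.PosDef.det_pos ?_
  refine Matrix.PosDef.of_dotProduct_mulVec_pos ?_ fun x hx => ?_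
  · ext i j
    simp [gram, hB.symm (EuclideanSpace.single j 1)]
  · have h := hB.pos (WithLp.toLp 2 x) (by simpa using hx)
    rw [apply_eq_sum_gram] at h
    simp only [dotProduct, Matrix.mulVec, Finset.mul_sum, Matrix.of_apply, star_trivial]
    refine h.trans_eq (Finset.sum_congr rfl fun i _ => Finset.sum_congr rfl fun j _ => ?_)
    ring

/-- The Gram matrix of a pulled back bilinear form. -/
theorem det_gram_comp {B B' : Bil (EuclideanSpace ℝ (Fin n))}
    (T : EuclideanSpace ℝ (Fin n) →L[ℝ] EuclideanSpace ℝ (Fin n))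
    (h : ∀ v w, B' v w = B (T v) (T w)) :
    (Matrix.of (gram B')).det = T.det ^ 2 * (Matrix.of (gram B)).det := by
  let b := (EuclideanSpace.basisFun (Fin n) ℝ).toBasis
  let A := LinearMap.toMatrix b b (T : EuclideanSpace ℝ (Fin n) →ₗ[ℝ] EuclideanSpace ℝ (Fin n))
  have hA : ∀ i j, A i j = T (EuclideanSpace.single j 1) i := by
    intro i j
    simp [A, b, LinearMap.toMatrix_apply]
  have h1 : Matrix.of (gram B') = Aᵀ * Matrix.of (gram B) * A := by
    ext i j
    rw [Matrix.of_apply, gram, h, apply_eq_sum_gram]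
    simp only [Matrix.mul_apply, Matrix.transpose_apply, hA, Finset.sum_mul, Matrix.of_apply]
    rw [Finset.sum_comm]
    refine Finset.sum_congr rfl fun k _ => Finset.sum_congr rfl fun l _ => ?_
    ring
  have h2 : A.det = T.det := LinearMap.det_toMatrix b _
  rw [h1, Matrix.det_mul, Matrix.det_mul, Matrix.det_transpose, h2]
  ring

/-- In the standard basis β = B(·, T·) for T = B⁻¹β, which uses both symmetries. This brings the
metric trace into the form appearing in Jacobi's formula. -/
theorem IsInner.trBil_eq_trace {B : Bil (EuclideanSpace ℝ (Fin n))} (hB : IsInner B)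
    {β : Bil (EuclideanSpace ℝ (Fin n))} (hβ : ∀ v w, β v w = β w v) :
    trBil B β = ((Matrix.of (gram B))⁻¹ * Matrix.of (gram β)).trace := by
  let b := (EuclideanSpace.basisFun (Fin n) ℝ).toBasis
  let T := B.inverse.comp β
  let A := LinearMap.toMatrix b b (T : EuclideanSpace ℝ (Fin n) →ₗ[ℝ] EuclideanSpace ℝ (Fin n))
  have hA : ∀ i j, A i j = T (EuclideanSpace.single j 1) i := by
    intro i j
    simp [A, b, LinearMap.toMatrix_apply]
  have h1 : Matrix.of (gram β) = Matrix.of (gram B) * A := by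
    ext i j
    have h2 : gram β i j = B (EuclideanSpace.single i 1) (T (EuclideanSpace.single j 1)) := by
      rw [hB.symm, gram, hβ]
      exact (hB.inverse_apply _ _).symm
    rw [Matrix.of_apply, h2, apply_eq_sum_gram, Matrix.mul_apply]
    simp only [hA, Matrix.of_apply]
    rw [Finset.sum_eq_single i]
    · exact Finset.sum_congr rfl fun k _ => by simp [mul_comm]
    · intro k _ hk
      simp [hk]
    · simp
  rw [h1, ← Matrix.mul_assoc, Matrix.nonsing_inv_mul _ hB.det_gram_pos.ne'.isUnit, Matrix.one_mul]
  exact LinearMap.trace_eq_matrix_trace ℝ b _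

variable {Ω : Set (EuclideanSpace ℝ (Fin n))}
  {G : EuclideanSpace ℝ (Fin n) → Bil (EuclideanSpace ℝ (Fin n))} {y : EuclideanSpace ℝ (Fin n)}

/-- The Riemannian density of the metric `G`. -/
noncomputable def density (G : EuclideanSpace ℝ (Fin n) → Bil (EuclideanSpace ℝ (Fin n)))
    (y : EuclideanSpace ℝ (Fin n)) : ℝ := √(Matrix.of (gram (G y))).det

theorem LocalMetric.density_pos (hG : LocalMetric Ω G) (hy : y ∈ Ω) : 0 < density G y :=
  Real.sqrt_pos.2 (hG.inner y hy).det_gram_pos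

theorem LocalMetric.contDiffOn_density (hG : LocalMetric Ω G) :
    ContDiffOn ℝ ∞ (density G) Ω := by
  refine ContDiffOn.sqrt ?_ fun y hy => (hG.inner y hy).det_gram_pos.ne'
  have h : ∀ i j, ContDiffOn ℝ ∞ (fun y => gram (G y) i j) Ω := fun i j =>
    (hG.smooth.clm_apply contDiffOn_const).clm_apply contDiffOn_const
  simp only [Matrix.det_apply, Matrix.of_apply, Units.smul_def, zsmul_eq_mul]
  exact ContDiffOn.sum fun σ _ => contDiffOn_const.mul (contDiffOn_prod fun i _ => h _ _)

/-- Jacobi's formula for the Gram determinant; the factor ½ comes from the square root. -/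
theorem LocalMetric.fderiv_density (hG : LocalMetric Ω G) (hy : y ∈ Ω)
    (a : EuclideanSpace ℝ (Fin n)) :
    fderiv ℝ (density G) y a = (1 / 2) * density G y * trBil (G y) (fderiv ℝ G y a) := by
  have hi := hG.inner y hy
  have hpos := hi.det_gram_pos
  have dG := hG.differentiableAt hy
  obtain ⟨hd, hdet⟩ := differentiableAt_det_and_fderiv (A := gram (G y)) hpos.ne'.isUnit
  have hg : HasFDerivAt (fun z => gram (G z))
      (ContinuousLinearMap.pi fun i => ContinuousLinearMap.pi fun j =>
        fderiv ℝ (fun z => gram (G z) i j) y) y := by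
    refine hasFDerivAt_pi.2 fun i => hasFDerivAt_pi.2 fun j => DifferentiableAt.hasFDerivAt ?_
    exact (dG.clm_apply (differentiableAt_const _)).clm_apply (differentiableAt_const _)
  have h1 : HasFDerivAt (fun z => (Matrix.of (gram (G z))).det) _ y := 
    HasFDerivAt.comp (g := fun B : Fin n → Fin n → ℝ => (Matrix.of B).det) y hd.hasFDerivAt hg
  have h2 : HasFDerivAt (density G) _ y := h1.sqrt hpos.ne'
  rw [h2.fderiv]
  have h3 : Matrix.of (gram (fderiv ℝ G y a)) =
      Matrix.of fun i j => fderiv ℝ (fun z => gram (G z) i j) y a := by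
    ext i j
    simp only [Matrix.of_apply, gram]
    rw [fderiv_const₂ dG]
  rw [hi.trBil_eq_trace (hG.fderiv_symm hy a), h3]
  simp only [smul_apply, ContinuousLinearMap.comp_apply, hdet, smul_eq_mul]
  have h4 : (Matrix.of (gram (G y))).det = density G y * density G y :=
    (Real.mul_self_sqrt hpos.le).symm
  have h5 := (hG.density_pos hy).ne'
  rw [h4, Real.sqrt_mul_self (hG.density_pos hy).le]
  field_simp
  rfl

/-- The divergence of a vector field, as the trace of the Lie derivative of the metric. -/
theorem LocalMetric.trace_fderiv (hG : LocalMetric Ω G) (hy : y ∈ Ω)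
    {X : EuclideanSpace ℝ (Fin n) → EuclideanSpace ℝ (Fin n)} (hX : DifferentiableAt ℝ X y)
    {χ : EuclideanSpace ℝ (Fin n) → ℝ} (hχ : DifferentiableAt ℝ χ y) :
    traceL _ (fderiv ℝ (fun z => (density G z * χ z) • X z) y) =
      density G y * (χ y * ((1 / 2) * trBil (G y) (lieBil X G y)) + fderiv ℝ χ y (X y)) := by
  have hi := hG.inner y hy
  obtain ⟨e, he⟩ := hi.exists_frame (n := n) (by simp)
  have dρ : DifferentiableAt ℝ (density G) y :=
    (hG.contDiffOn_density.contDiffAt (hG.isOpen.mem_nhds hy)).differentiableAt (by simp)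
  -- By symmetry of G the two terms of L_X G containing dX both have trace tr dX. Together with
  -- dG(X) this is the usual ρ⁻¹ div(ρX), up to the factor 2.
  have h1 : trBil (G y) (lieBil X G y) =
      trBil (G y) (fderiv ℝ G y (X y)) + 2 * traceL _ (fderiv ℝ X y) := by
    rw [hi.trBil_eq he (by simp), hi.trBil_eq he (by simp), he.traceL_eq (by simp)]
    simp only [lieBil_apply, Finset.sum_add_distrib, hi.symm (e _) (fderiv ℝ X y (e _))]
    ring
  have h2 : ∀ (α : EuclideanSpace ℝ (Fin n) →L[ℝ] ℝ) (v : EuclideanSpace ℝ (Fin n)),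
      traceL _ (α.smulRight v) = α v := by
    intro α v
    rw [he.traceL_eq (by simp)]
    conv_rhs => rw [← he.sum_smul (by simp) v]
    simp only [map_sum, map_smul, smul_eq_mul, ContinuousLinearMap.smulRight_apply, smul_apply]
    exact Finset.sum_congr rfl fun i _ => by ring
  rw [fderiv_fun_smul (dρ.fun_mul hχ) hX, map_add, map_smul, fderiv_fun_mul dρ hχ, h1, h2]
  simp only [add_apply, smul_apply, smul_eq_mul, hG.fderiv_density hy]
  ring

end LocalGeom

/-! ### Volume measures of charts and change of coordinates -/

namespace RiemGeom

open Module Filter Topology LocalGeom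

variable {n : ℕ} {M : Type*} [TopologicalSpace M] [ChartedSpace (EuclideanSpace ℝ (Fin n)) M]

theorem measurableSet_target_inter_preimage [MeasurableSpace M] [BorelSpace M] (c : M) {s : Set M}
    (hs : MeasurableSet s) :
    MeasurableSet ((extChartAt (𝓡 n) c).target ∩ (extChartAt (𝓡 n) c).symm ⁻¹' s) := by
  have hm : MeasurableSet (extChartAt (𝓡 n) c).target :=
    (isOpen_extChartAt_target (I := 𝓡 n) c).measurableSet
  have hc : Continuous ((extChartAt (𝓡 n) c).target.domRestrict (extChartAt (𝓡 n) c).symm) :=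
    continuousOn_iff_continuous_domRestrict.1 (continuousOn_extChartAt_symm c)
  have h := hm.subtype_image (hc.measurable hs)
  convert h using 1
  ext y
  exact ⟨fun hy => ⟨⟨y, hy.1⟩, hy.2, rfl⟩, by rintro ⟨z, hz, rfl⟩; exact ⟨z.2, hz⟩⟩

variable [IsManifold (𝓡 n) ∞ M] {c c' : M} {y : EuclideanSpace ℝ (Fin n)}

theorem chartFrame_mfderiv (hy : y ∈ (extChartAt (𝓡 n) c).target)
    (v : TangentSpace (𝓡 n) ((extChartAt (𝓡 n) c).symm y)) :
    chartFrame c y (mfderiv (𝓡 n) 𝓘(ℝ, EuclideanSpace ℝ (Fin n)) (extChartAt (𝓡 n) c)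
      ((extChartAt (𝓡 n) c).symm y) v) = v := by
  obtain ⟨a, rfl⟩ := chartFrame_surjective hy v
  have h1 := mfderiv_comp y ((contMDiffAt_chart hy).mdifferentiableAt (by simp))
    ((contMDiffAt_symm hy).mdifferentiableAt (by simp))
  have h2 : (extChartAt (𝓡 n) c ∘ (extChartAt (𝓡 n) c).symm) =ᶠ[𝓝 y] id := by
    filter_upwards [target_mem_nhds hy] with z hz using (extChartAt (𝓡 n) c).right_inv hz
  rw [h2.mfderiv_eq, mfderiv_id] at h1
  have h3 := congrArg (fun T => T a) h1
  exact congrArg (chartFrame c y) h3.symm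

/-- The metric at a point of the domain of a chart, in terms of its coordinate expression. -/
theorem tensor_eq_chartMetric (g : Metric n M) {x : M} (hx : x ∈ (extChartAt (𝓡 n) c).source)
    (v w : TangentSpace (𝓡 n) x) :
    g.tensor x v w = chartMetric g c (extChartAt (𝓡 n) c x)
      (mfderiv (𝓡 n) 𝓘(ℝ, EuclideanSpace ℝ (Fin n)) (extChartAt (𝓡 n) c) x v)
      (mfderiv (𝓡 n) 𝓘(ℝ, EuclideanSpace ℝ (Fin n)) (extChartAt (𝓡 n) c) x w) := by
  have main : ∀ y ∈ (extChartAt (𝓡 n) c).target,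
      ∀ v w : TangentSpace (𝓡 n) ((extChartAt (𝓡 n) c).symm y),
      g.tensor ((extChartAt (𝓡 n) c).symm y) v w =
        chartMetric g c (extChartAt (𝓡 n) c ((extChartAt (𝓡 n) c).symm y))
        (mfderiv (𝓡 n) 𝓘(ℝ, EuclideanSpace ℝ (Fin n)) (extChartAt (𝓡 n) c)
          ((extChartAt (𝓡 n) c).symm y) v)
        (mfderiv (𝓡 n) 𝓘(ℝ, EuclideanSpace ℝ (Fin n)) (extChartAt (𝓡 n) c)
          ((extChartAt (𝓡 n) c).symm y) w) := by
    intro y hy v w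
    have h := tensorRep_chartMetric g c y hy
      (mfderiv (𝓡 n) 𝓘(ℝ, EuclideanSpace ℝ (Fin n)) (extChartAt (𝓡 n) c)
          ((extChartAt (𝓡 n) c).symm y) v)
      (mfderiv (𝓡 n) 𝓘(ℝ, EuclideanSpace ℝ (Fin n)) (extChartAt (𝓡 n) c)
          ((extChartAt (𝓡 n) c).symm y) w)
    rw [chartFrame_mfderiv hy, chartFrame_mfderiv hy] at h
    rw [h, (extChartAt (𝓡 n) c).right_inv hy]
  have h := main _ ((extChartAt (𝓡 n) c).map_source hx)
  rw [(extChartAt (𝓡 n) c).left_inv hx] at h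
  exact h v w

/-- The transition map from the chart at `c` to the chart at `c'`. -/
noncomputable def transition (c c' : M) (y : EuclideanSpace ℝ (Fin n)) : EuclideanSpace ℝ (Fin n) :=
  extChartAt (𝓡 n) c' ((extChartAt (𝓡 n) c).symm y)

theorem mdifferentiableAt_chart {x : M} (hx : x ∈ (extChartAt (𝓡 n) c).source) :
    MDifferentiableAt (𝓡 n) 𝓘(ℝ, EuclideanSpace ℝ (Fin n)) (extChartAt (𝓡 n) c) x :=
  (contMDiffAt_extChartAt' (n := ∞) (by rwa [← extChartAt_source (𝓡 n)])).mdifferentiableAt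
    (by simp)

theorem differentiableAt_transition (hy : y ∈ (extChartAt (𝓡 n) c).target)
    (hx : (extChartAt (𝓡 n) c).symm y ∈ (extChartAt (𝓡 n) c').source) :
    DifferentiableAt ℝ (transition c c') y :=
  ((mdifferentiableAt_chart hx).comp y
    ((contMDiffAt_symm hy).mdifferentiableAt (by simp))).differentiableAt

theorem chartMetric_transition (g : Metric n M) (hy : y ∈ (extChartAt (𝓡 n) c).target)
    (hx : (extChartAt (𝓡 n) c).symm y ∈ (extChartAt (𝓡 n) c').source)
    (v w : EuclideanSpace ℝ (Fin n)) :
    chartMetric g c y v w = chartMetric g c' (transition c c' y)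
      (fderiv ℝ (transition c c') y v) (fderiv ℝ (transition c c') y w) := by
  have h := mfderiv_comp y (mdifferentiableAt_chart hx)
    ((contMDiffAt_symm hy).mdifferentiableAt (by simp))
  have h' : ∀ v, fderiv ℝ (transition c c') y v =
      mfderiv (𝓡 n) 𝓘(ℝ, EuclideanSpace ℝ (Fin n)) (extChartAt (𝓡 n) c')
        ((extChartAt (𝓡 n) c).symm y) (chartFrame c y v) := by
    intro v
    rw [← mfderiv_eq_fderiv]
    exact congrArg (fun T => T v) h
  rw [h', h', ← tensorRep_chartMetric g c y hy, tensor_eq_chartMetric g hx]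
  rfl

/-- The two Gram matrices are related by the Jacobian matrix and its transpose, so their
determinants differ by the squared Jacobian. This factor is exactly the one in the change of
variables formula. -/
theorem density_transition (g : Metric n M) (hy : y ∈ (extChartAt (𝓡 n) c).target)
    (hx : (extChartAt (𝓡 n) c).symm y ∈ (extChartAt (𝓡 n) c').source) :
    density (chartMetric g c) y = |(fderiv ℝ (transition c c') y).det| *
      density (chartMetric g c') (transition c c' y) := by
  rw [density, det_gram_comp _ (chartMetric_transition g hy hx), Real.sqrt_mul (sq_nonneg _),
    Real.sqrt_sq_eq_abs, density]

theorem volDensity_eq (g : Metric n M) (c : M) :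
    volDensity g.tensor c = density (chartMetric g c) := rfl

omit [IsManifold (𝓡 n) ∞ M] in
theorem injOn_transition (c c' : M) : Set.InjOn (transition (n := n) c c')
    ((extChartAt (𝓡 n) c).target ∩
      (extChartAt (𝓡 n) c).symm ⁻¹' (extChartAt (𝓡 n) c').source) :=
  fun _ hy _ hz h => (extChartAt (𝓡 n) c).symm.injOn hy.1 hz.1
    ((extChartAt (𝓡 n) c').injOn hy.2 hz.2 h)

omit [IsManifold (𝓡 n) ∞ M] in
theorem image_transition (c c' : M) {s : Set M} (hs : s ⊆ (extChartAt (𝓡 n) c).source)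
    (hs' : s ⊆ (extChartAt (𝓡 n) c').source) :
    transition c c' '' ((extChartAt (𝓡 n) c).target ∩ (extChartAt (𝓡 n) c).symm ⁻¹' s) =
      (extChartAt (𝓡 n) c').target ∩ (extChartAt (𝓡 n) c').symm ⁻¹' s := by
  ext z
  constructor
  · rintro ⟨y, ⟨-, hys⟩, rfl⟩
    refine ⟨(extChartAt (𝓡 n) c').map_source (hs' hys), ?_⟩
    rw [Set.mem_preimage, transition, (extChartAt (𝓡 n) c').left_inv (hs' hys)]
    exact hys
  · rintro ⟨hz, hzs⟩
    have hzs' : (extChartAt (𝓡 n) c').symm z ∈ s := hzs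
    refine ⟨extChartAt (𝓡 n) c ((extChartAt (𝓡 n) c').symm z),
      ⟨(extChartAt (𝓡 n) c).map_source (hs hzs'), ?_⟩, ?_⟩
    · rw [Set.mem_preimage, (extChartAt (𝓡 n) c).left_inv (hs hzs')]
      exact hzs'
    · rw [transition, (extChartAt (𝓡 n) c).left_inv (hs hzs'), (extChartAt (𝓡 n) c').right_inv hz]

section Measure

variable [MeasurableSpace M] [BorelSpace M]

omit [IsManifold (𝓡 n) ∞ M] in
theorem aemeasurable_chart_symm (h : Tensor2 n M) (c : M) :
    AEMeasurable (extChartAt (𝓡 n) c).symm ((volume.restrict (extChartAt (𝓡 n) c).target).withDensity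
      fun y => ENNReal.ofReal (volDensity h c y)) :=
  ((continuousOn_extChartAt_symm c).aemeasurable
    (isOpen_extChartAt_target (I := 𝓡 n) c).measurableSet).mono_ac
    (withDensity_absolutelyContinuous _ _)

omit [IsManifold (𝓡 n) ∞ M] in
theorem chartVolume_apply (h : Tensor2 n M) (c : M) {s : Set M} (hs : MeasurableSet s) :
    chartVolume h c s =
      ∫⁻ y in (extChartAt (𝓡 n) c).target ∩ (extChartAt (𝓡 n) c).symm ⁻¹' s,
        ENNReal.ofReal (volDensity h c y) := by
  rw [chartVolume, Measure.map_apply_of_aemeasurable (aemeasurable_chart_symm h c) hs,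
    withDensity_apply', Measure.restrict_restrict'
      (isOpen_extChartAt_target (I := 𝓡 n) c).measurableSet, Set.inter_comm]

/-- The volume measures of two charts agree on the intersection of their domains. -/
theorem chartVolume_eq (g : Metric n M) (c c' : M) {s : Set M} (hs : MeasurableSet s)
    (h : s ⊆ (extChartAt (𝓡 n) c).source) (h' : s ⊆ (extChartAt (𝓡 n) c').source) :
    chartVolume g.tensor c s = chartVolume g.tensor c' s := by
  have hsub : (extChartAt (𝓡 n) c).target ∩ (extChartAt (𝓡 n) c).symm ⁻¹' s ⊆
      (extChartAt (𝓡 n) c).target ∩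
        (extChartAt (𝓡 n) c).symm ⁻¹' (extChartAt (𝓡 n) c').source :=
    Set.inter_subset_inter_right _ (Set.preimage_mono h')
  have hm := measurableSet_target_inter_preimage (n := n) c hs
  rw [chartVolume_apply _ _ hs, chartVolume_apply _ _ hs, ← image_transition c c' h h',
    lintegral_image_eq_lintegral_abs_det_fderiv_mul volume hm
      (fun y hy => (differentiableAt_transition (hsub hy).1
        (hsub hy).2).hasFDerivAt.hasFDerivWithinAt) ((injOn_transition c c').mono hsub)]
  refine setLIntegral_congr_fun hm fun y hy => ?_
  rw [← ENNReal.ofReal_mul (abs_nonneg _), volDensity_eq, volDensity_eq,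
    density_transition g (hsub hy).1 (hsub hy).2]

theorem chartVolume_restrict_eq (g : Metric n M) (c c' : M) {s : Set M} (hs : MeasurableSet s)
    (h : s ⊆ (extChartAt (𝓡 n) c).source) (h' : s ⊆ (extChartAt (𝓡 n) c').source) :
    (chartVolume g.tensor c).restrict s = (chartVolume g.tensor c').restrict s := by
  ext t ht
  rw [Measure.restrict_apply ht, Measure.restrict_apply ht]
  exact chartVolume_eq g c c' (ht.inter hs) (Set.inter_subset_right.trans h)
    (Set.inter_subset_right.trans h')

-- The measure is pushed forward from the target of the chart, so it gives no mass outside the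
-- source.
omit [IsManifold (𝓡 n) ∞ M] in
theorem chartVolume_restrict_source (h : Tensor2 n M) (c : M) :
    (chartVolume h c).restrict (extChartAt (𝓡 n) c).source = chartVolume h c := by
  have hm : MeasurableSet (extChartAt (𝓡 n) c).source :=
    (isOpen_extChartAt_source (I := 𝓡 n) c).measurableSet
  refine Measure.restrict_eq_self_of_ae_mem ?_
  rw [ae_iff]
  change chartVolume h c (extChartAt (𝓡 n) c).sourceᶜ = 0
  rw [chartVolume_apply _ _ hm.compl]
  have : (extChartAt (𝓡 n) c).target ∩
      (extChartAt (𝓡 n) c).symm ⁻¹' (extChartAt (𝓡 n) c).sourceᶜ = ∅ := by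
    ext y
    simp only [Set.mem_inter_iff, Set.mem_preimage, Set.mem_compl_iff, Set.mem_empty_iff_false,
      iff_false, not_and, not_not]
    exact fun hy => (extChartAt (𝓡 n) c).map_target hy
  rw [this, Measure.restrict_empty, lintegral_zero_measure]

/-- Integration over the domain of a chart. -/
theorem integral_chartVolume (g : Metric n M) (c : M) {F : M → ℝ}
    (hF : AEStronglyMeasurable F (chartVolume g.tensor c)) :
    ∫ x, F x ∂(chartVolume g.tensor c) = ∫ y in (extChartAt (𝓡 n) c).target,
      density (chartMetric g c) y * F ((extChartAt (𝓡 n) c).symm y) := by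
  rw [chartVolume, integral_map (aemeasurable_chart_symm _ _) hF,
    integral_withDensity_eq_integral_toReal_smul₀]
  · refine integral_congr_ae (ae_of_all _ fun y => ?_)
    simp only [smul_eq_mul, volDensity_eq]
    rw [ENNReal.toReal_ofReal (show 0 ≤ density _ y from Real.sqrt_nonneg _)]
  · exact (((localMetric_chartMetric g c).contDiffOn_density.continuousOn.aemeasurable
      (isOpen_extChartAt_target (I := 𝓡 n) c).measurableSet)).ennreal_ofReal
  · exact ae_of_all _ fun _ => ENNReal.ofReal_lt_top

/-- The density is continuous on the compact coordinate image of K. Compactness inside the chart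
domain matters, since √(det g) may fail to be bounded near the edge of the chart. -/
theorem chartVolume_lt_top_of_isCompact [T2Space M] (g : Metric n M) (c : M) {K : Set M}
    (hK : IsCompact K) (hKc : K ⊆ (extChartAt (𝓡 n) c).source) :
    chartVolume g.tensor c K < ⊤ := by
  have hK' : IsCompact (extChartAt (𝓡 n) c '' K) :=
    hK.image_of_continuousOn ((continuousOn_extChartAt c).mono hKc)
  have hsub : extChartAt (𝓡 n) c '' K ⊆ (extChartAt (𝓡 n) c).target := by
    rintro _ ⟨x, hx, rfl⟩
    exact (extChartAt (𝓡 n) c).map_source (hKc hx)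
  have hi : IntegrableOn (density (chartMetric g c)) (extChartAt (𝓡 n) c '' K) :=
    ((localMetric_chartMetric g c).contDiffOn_density.continuousOn.mono
      hsub).integrableOn_compact hK'
  rw [chartVolume_apply _ _ hK.measurableSet]
  refine (lintegral_mono_set ?_).trans_lt (hi.lintegral_lt_top)
  rintro y ⟨hy, hyK⟩
  exact ⟨_, hyK, (extChartAt (𝓡 n) c).right_inv hy⟩

end Measure

end RiemGeom

/-! ### The glued Riemannian volume measure on a compact manifold -/

namespace RiemGeom

open Module Filter Topology LocalGeom

variable {n : ℕ} {M : Type*} [TopologicalSpace M] [ChartedSpace (EuclideanSpace ℝ (Fin n)) M]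
  [IsManifold (𝓡 n) ∞ M] [T2Space M] [CompactSpace M]

theorem tsupport_chartPartition_subset (c : M) :
    tsupport (chartPartition n M c) ⊆ (extChartAt (𝓡 n) c).source := by
  rw [extChartAt_source]
  exact (SmoothPartitionOfUnity.exists_isSubordinate_chartAt_source (𝓡 n) M).choose_spec c

variable (n M) in
/-- The indices of the partition functions that do not vanish identically. -/
noncomputable def partitionFinset : Finset M :=
  ((chartPartition n M).locallyFinite.finite_nonempty_of_compact).toFinset

theorem chartPartition_eq_zero {c : M} (hc : c ∉ partitionFinset n M) (x : M) :
    chartPartition n M c x = 0 := by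
  by_contra hx
  exact hc ((Set.Finite.mem_toFinset _).2 ⟨x, hx⟩)

theorem sum_chartPartition (x : M) : ∑ c ∈ partitionFinset n M, chartPartition n M c x = 1 := by
  rw [← (chartPartition n M).sum_eq_one (Set.mem_univ x)]
  refine (finsum_eq_sum_of_support_subset _ fun c hc => ?_).symm
  by_contra h
  exact hc (chartPartition_eq_zero h x)

variable [MeasurableSpace M] [BorelSpace M]

omit [BorelSpace M] in
theorem volumeMeasure_eq_sum (h : Tensor2 n M) : volumeMeasure h =
    ∑ c ∈ partitionFinset n M,
      (chartVolume h c).withDensity fun x => ENNReal.ofReal (chartPartition n M c x) := by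
  ext s hs
  rw [volumeMeasure, Measure.sum_apply _ hs, Measure.finsetSum_apply]
  refine tsum_eq_sum fun c hc => ?_
  simp only [chartPartition_eq_zero hc, ENNReal.ofReal_zero]
  rw [withDensity_apply _ hs, lintegral_zero]

theorem withDensity_chartPartition_lt_top (g : Metric n M) (c : M) :
    (chartVolume g.tensor c).withDensity (fun x => ENNReal.ofReal (chartPartition n M c x))
      Set.univ < ⊤ := by
  have hK : IsCompact (tsupport (chartPartition n M c)) := (isClosed_tsupport _).isCompact
  rw [withDensity_apply _ MeasurableSet.univ, Measure.restrict_univ]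
  refine lt_of_le_of_lt ?_
    (chartVolume_lt_top_of_isCompact g c hK (tsupport_chartPartition_subset c))
  rw [← lintegral_indicator_one hK.measurableSet]
  refine lintegral_mono fun x => ?_
  by_cases hx : x ∈ tsupport (chartPartition n M c)
  · rw [Set.indicator_of_mem hx]
    exact ENNReal.ofReal_le_one.2 ((chartPartition n M).le_one c x)
  · rw [image_eq_zero_of_notMem_tsupport hx, ENNReal.ofReal_zero]
    exact zero_le

theorem isFiniteMeasure_volumeMeasure (g : Metric n M) :
    IsFiniteMeasure (volumeMeasure g.tensor) := by
  refine ⟨?_⟩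
  rw [volumeMeasure_eq_sum, Measure.finsetSum_apply]
  exact ENNReal.sum_lt_top.2 fun c _ => withDensity_chartPartition_lt_top g c

/-- The partition function at c' vanishes off its own chart domain, and on the overlap of the two
domains the chart measures coincide. -/
theorem setLIntegral_chartPartition (g : Metric n M) (c c' : M) {s : Set M} (hs : MeasurableSet s)
    (h : s ⊆ (extChartAt (𝓡 n) c).source) :
    ∫⁻ x in s, ENNReal.ofReal (chartPartition n M c' x) ∂(chartVolume g.tensor c') =
      ∫⁻ x in s, ENNReal.ofReal (chartPartition n M c' x) ∂(chartVolume g.tensor c) := by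
  have hm : MeasurableSet (extChartAt (𝓡 n) c').source :=
    (isOpen_extChartAt_source (I := 𝓡 n) c').measurableSet
  have key : ∀ μ : Measure M, ∫⁻ x in s, ENNReal.ofReal (chartPartition n M c' x) ∂μ =
      ∫⁻ x in s ∩ (extChartAt (𝓡 n) c').source, ENNReal.ofReal (chartPartition n M c' x) ∂μ := by
    intro μ
    rw [Set.inter_comm, ← setLIntegral_indicator hm]
    refine lintegral_congr fun x => ?_
    by_cases hx : x ∈ (extChartAt (𝓡 n) c').source
    · rw [Set.indicator_of_mem hx]
    · rw [Set.indicator_of_notMem hx,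
        image_eq_zero_of_notMem_tsupport fun h => hx (tsupport_chartPartition_subset c' h),
        ENNReal.ofReal_zero]
  rw [key, key, chartVolume_restrict_eq g c' c (hs.inter hm) Set.inter_subset_right
    (Set.inter_subset_left.trans h)]

/-- In the domain of a chart, the Riemannian volume measure is the volume measure of the chart. -/
theorem volumeMeasure_restrict_source (g : Metric n M) (c : M) :
    (volumeMeasure g.tensor).restrict (extChartAt (𝓡 n) c).source = chartVolume g.tensor c := by
  have hm : MeasurableSet (extChartAt (𝓡 n) c).source :=
    (isOpen_extChartAt_source (I := 𝓡 n) c).measurableSet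
  rw [← chartVolume_restrict_source]
  ext t ht
  have hs := ht.inter hm
  rw [Measure.restrict_apply ht, Measure.restrict_apply ht, volumeMeasure_eq_sum,
    Measure.finsetSum_apply]
  have h1 : ∀ c' ∈ partitionFinset n M, (chartVolume g.tensor c').withDensity
      (fun x => ENNReal.ofReal (chartPartition n M c' x)) (t ∩ (extChartAt (𝓡 n) c).source) =
      ∫⁻ x in t ∩ (extChartAt (𝓡 n) c).source,
        ENNReal.ofReal (chartPartition n M c' x) ∂(chartVolume g.tensor c) := fun c' _ => by
    rw [withDensity_apply _ hs, setLIntegral_chartPartition g c c' hs Set.inter_subset_right]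
  rw [Finset.sum_congr rfl h1, ← lintegral_finsetSum _ fun c' _ =>
    (chartPartition n M c').contMDiff.continuous.measurable.ennreal_ofReal]
  rw [lintegral_congr fun x => (ENNReal.ofReal_sum_of_nonneg fun c' _ =>
    (chartPartition n M).nonneg c' x).symm]
  simp [sum_chartPartition]

end RiemGeom

/-! ### The divergence theorem in Euclidean space -/

namespace LocalGeom

open Module Filter Topology

variable {n : ℕ}

theorem traceL_eq_sum (T : EuclideanSpace ℝ (Fin n) →L[ℝ] EuclideanSpace ℝ (Fin n)) :
    traceL _ T = ∑ i, T (EuclideanSpace.single i 1) i := by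
  have h := LinearMap.trace_eq_matrix_trace ℝ (EuclideanSpace.basisFun (Fin n) ℝ).toBasis
    (T : EuclideanSpace ℝ (Fin n) →ₗ[ℝ] EuclideanSpace ℝ (Fin n))
  refine h.trans ?_
  simp [Matrix.trace, LinearMap.toMatrix_apply]

/-- Integration by parts against the constant function 1; compact support supplies integrability. -/
theorem integral_fderiv_eq_zero {E : Type*} [NormedAddCommGroup E] [NormedSpace ℝ E]
    [FiniteDimensional ℝ E] [MeasurableSpace E] [BorelSpace E] (μ : Measure E) [μ.IsAddHaarMeasure]
    {f : E → ℝ} (hf : ContDiff ℝ 1 f) (hc : HasCompactSupport f) (v : E) :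
    ∫ x, fderiv ℝ f x v ∂μ = 0 := by
  have hi : Integrable (fun x => fderiv ℝ f x v) μ :=
    ((hf.continuous_fderiv (by simp)).clm_apply continuous_const).integrable_of_hasCompactSupport
      (hc.fderiv_apply (𝕜 := ℝ) v)
  have h := integral_mul_fderiv_eq_neg_fderiv_mul_of_integrable (μ := μ) (𝕜 := ℝ)
    (f := fun _ : E => (1 : ℝ)) (g := f) (v := v) (by simp) (by simpa using hi)
    (by simpa using hf.continuous.integrable_of_hasCompactSupport hc)
    (fun x _ => differentiableAt_const _) (fun x _ => hf.differentiable (by simp) x)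
  simpa using h

/-- The divergence theorem for a vector field with compact support in an open set. -/
theorem setIntegral_trace_fderiv_eq_zero {Ω K : Set (EuclideanSpace ℝ (Fin n))} (hΩ : IsOpen Ω)
    (hK : IsCompact K) (hKΩ : K ⊆ Ω) {W : EuclideanSpace ℝ (Fin n) → EuclideanSpace ℝ (Fin n)}
    (hW : ContDiffOn ℝ 1 W Ω) (h0 : ∀ y ∈ Ω, y ∉ K → W y = 0) :
    ∫ y in Ω, traceL _ (fderiv ℝ W y) = 0 := by
  -- The extension of W by zero: near K it equals W, and off the closed set K it vanishes locally,
  -- so it is C¹ on the whole space.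
  set V := Ω.indicator W with hV
  have hV0 : ∀ y ∉ K, V y = 0 := by
    intro y hy
    by_cases hyΩ : y ∈ Ω
    · rw [hV, Set.indicator_of_mem hyΩ, h0 y hyΩ hy]
    · rw [hV, Set.indicator_of_notMem hyΩ]
  have hVW : ∀ y ∈ Ω, V =ᶠ[𝓝 y] W := fun y hy => by
    filter_upwards [hΩ.mem_nhds hy] with z hz using Set.indicator_of_mem hz W
  have hVe : ∀ y ∉ K, V =ᶠ[𝓝 y] fun _ => 0 := fun y hy => by
    filter_upwards [hK.isClosed.isOpen_compl.mem_nhds hy] with z hz using hV0 z hz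
  have hVs : ContDiff ℝ 1 V := by
    rw [contDiff_iff_contDiffAt]
    intro y
    by_cases hy : y ∈ K
    · exact (hW.contDiffAt (hΩ.mem_nhds (hKΩ hy))).congr_of_eventuallyEq (hVW y (hKΩ hy))
    · exact contDiffAt_const.congr_of_eventuallyEq (hVe y hy)
  have hVc : HasCompactSupport V := HasCompactSupport.intro hK hV0
  have h1 : ∫ y in Ω, traceL _ (fderiv ℝ W y) = ∫ y, traceL _ (fderiv ℝ V y) := by
    rw [← setIntegral_eq_integral_of_forall_compl_eq_zero (s := Ω)
      (f := fun y => traceL _ (fderiv ℝ V y))]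
    · refine setIntegral_congr_fun hΩ.measurableSet fun y hy => ?_
      rw [(hVW y hy).fderiv_eq]
    · intro y hy
      rw [(hVe y fun h => hy (hKΩ h)).fderiv_eq]
      simp
  have hcoord : ∀ i, ContDiff ℝ 1 (fun y => V y i) := fun i => (contDiff_euclidean.1 hVs) i
  have hsupp : ∀ i, HasCompactSupport (fun y => V y i) := fun i =>
    HasCompactSupport.intro hK fun y hy => by simp [hV0 y hy]
  have hd : ∀ y v i, fderiv ℝ V y v i = fderiv ℝ (fun y => V y i) y v := by
    intro y v i
    have h : HasFDerivAt (fun y => V y i) _ y :=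
      (EuclideanSpace.proj (𝕜 := ℝ) i).hasFDerivAt.comp y
        (hVs.differentiable (by simp) y).hasFDerivAt
    rw [h.fderiv]
    rfl
  rw [h1]
  simp only [traceL_eq_sum, hd]
  rw [integral_finsetSum]
  · exact Finset.sum_eq_zero fun i _ => integral_fderiv_eq_zero _ (hcoord i) (hsupp i) _
  · exact fun i _ => (((hcoord i).continuous_fderiv (by simp)).clm_apply
      continuous_const).integrable_of_hasCompactSupport ((hsupp i).fderiv_apply (𝕜 := ℝ) _)

end LocalGeom

/-! ### The divergence theorem on M -/

namespace RiemGeom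

open Module Filter Topology LocalGeom

variable {n : ℕ} {M : Type*} [TopologicalSpace M] [ChartedSpace (EuclideanSpace ℝ (Fin n)) M]

/-- Continuity of a function can be tested in charts. -/
theorem continuous_of_chart {F : M → ℝ} (h : ∀ c : M, ContinuousOn
    (fun y => F ((extChartAt (𝓡 n) c).symm y)) (extChartAt (𝓡 n) c).target) : Continuous F := by
  rw [continuous_iff_continuousAt]
  intro x
  have h1 : ContinuousAt (fun y => F ((extChartAt (𝓡 n) x).symm y)) (extChartAt (𝓡 n) x x) :=
    (h x).continuousAt (target_mem_nhds (mem_extChartAt_target x))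
  have h2 := ContinuousAt.comp (f := extChartAt (𝓡 n) x) h1 (continuousAt_extChartAt x)
  refine h2.congr ?_
  filter_upwards [extChartAt_source_mem_nhds (I := 𝓡 n) x] with z hz
  rw [Function.comp_apply, (extChartAt (𝓡 n) x).left_inv hz]

variable [IsManifold (𝓡 n) ∞ M] {g : Metric n M} {θ : OneForm n M} {c : M}
  {y : EuclideanSpace ℝ (Fin n)}

theorem traceAt_deltaStar (hθ : IsSmoothOneForm θ) (hy : y ∈ (extChartAt (𝓡 n) c).target) :
    traceAt g.tensor ((extChartAt (𝓡 n) c).symm y)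
      (deltaStar g.tensor θ ((extChartAt (𝓡 n) c).symm y)) =
      (1 / 2) * trBil (chartMetric g c y) (lieBil (chartSharp g θ c) (chartMetric g c) y) := by
  rw [traceAt_eq g (K := (1 / 2 : ℝ) • lieBil (chartSharp g θ c) (chartMetric g c) y) hy
    (fun a b => by rw [tensorRep_deltaStar g hθ c hy]; simp)]
  simp [trBil]

theorem dirDeriv_sharp {χ : M → ℝ} (hχ : ContMDiff (𝓡 n) 𝓘(ℝ, ℝ) ∞ χ)
    (hy : y ∈ (extChartAt (𝓡 n) c).target) :
    dirDeriv χ ((extChartAt (𝓡 n) c).symm y) (sharp g.tensor θ ((extChartAt (𝓡 n) c).symm y)) =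
      fderiv ℝ (fun z => χ ((extChartAt (𝓡 n) c).symm z)) y (chartSharp g θ c y) := by
  rw [sharp_eq g θ hy, dirDeriv_chartFrame hy]
  exact ((contDiffOn_comp_symm hχ c).contDiffAt (target_mem_nhds hy)).differentiableAt (by simp)

theorem continuous_traceAt_deltaStar (g : Metric n M) (hθ : IsSmoothOneForm θ) :
    Continuous fun x => traceAt g.tensor x (deltaStar g.tensor θ x) := by
  refine continuous_of_chart (n := n) fun c => ?_
  have hG := localMetric_chartMetric g c
  refine ContinuousOn.congr (continuousOn_const.mul (hG.contDiffOn_trBil (contDiffOn_lieBil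
    hG.isOpen (contDiffOn_chartSharp g hθ c) hG.smooth)).continuousOn)
    fun y hy => traceAt_deltaStar hθ hy

theorem continuous_dirDeriv_sharp (g : Metric n M) (hθ : IsSmoothOneForm θ) {χ : M → ℝ}
    (hχ : ContMDiff (𝓡 n) 𝓘(ℝ, ℝ) ∞ χ) :
    Continuous fun x => dirDeriv χ x (sharp g.tensor θ x) := by
  refine continuous_of_chart (n := n) fun c => ?_
  refine ContinuousOn.congr ?_ fun y hy => dirDeriv_sharp hχ hy
  exact (((contDiffOn_comp_symm hχ c).fderiv_of_isOpen (m := ∞) (isOpen_extChartAt_target c)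
    (by simp)).clm_apply (contDiffOn_chartSharp g hθ c)).continuousOn

variable [T2Space M] [CompactSpace M] [MeasurableSpace M] [BorelSpace M]

omit [T2Space M] in
/-- The divergence theorem for a vector field supported in the domain of a chart. -/
theorem integral_chartVolume_eq_zero (g : Metric n M) (hθ : IsSmoothOneForm θ) {χ : M → ℝ}
    (hχ : ContMDiff (𝓡 n) 𝓘(ℝ, ℝ) ∞ χ) (c : M) (hc : tsupport χ ⊆ (extChartAt (𝓡 n) c).source) :
    ∫ x, (χ x * traceAt g.tensor x (deltaStar g.tensor θ x) +
      dirDeriv χ x (sharp g.tensor θ x)) ∂(chartVolume g.tensor c) = 0 := by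
  have hG := localMetric_chartMetric g c
  have hX := contDiffOn_chartSharp g hθ c
  have hχc := contDiffOn_comp_symm hχ c
  have hcont : Continuous fun x => χ x * traceAt g.tensor x (deltaStar g.tensor θ x) +
      dirDeriv χ x (sharp g.tensor θ x) :=
    (hχ.continuous.mul (continuous_traceAt_deltaStar g hθ)).add (continuous_dirDeriv_sharp g hθ hχ)
  rw [integral_chartVolume g c hcont.aestronglyMeasurable]
  have hK : IsCompact (extChartAt (𝓡 n) c '' tsupport χ) :=
    (isClosed_tsupport χ).isCompact.image_of_continuousOn ((continuousOn_extChartAt c).mono hc)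
  have hKsub : extChartAt (𝓡 n) c '' tsupport χ ⊆ (extChartAt (𝓡 n) c).target := by
    rintro _ ⟨x, hx, rfl⟩
    exact (extChartAt (𝓡 n) c).map_source (hc hx)
  rw [← setIntegral_trace_fderiv_eq_zero hG.isOpen hK hKsub
    (W := fun z => (density (chartMetric g c) z * χ ((extChartAt (𝓡 n) c).symm z)) •
      chartSharp g θ c z) (((hG.contDiffOn_density.mul hχc).smul hX).of_le ENat.LEInfty.out)]
  · refine setIntegral_congr_fun hG.isOpen.measurableSet fun y hy => ?_
    rw [hG.trace_fderiv hy ((hX.contDiffAt (target_mem_nhds hy)).differentiableAt (by simp))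
      (χ := fun z => χ ((extChartAt (𝓡 n) c).symm z))
      ((hχc.contDiffAt (target_mem_nhds hy)).differentiableAt (by simp)),
      traceAt_deltaStar hθ hy, dirDeriv_sharp hχ hy]
  · intro y hy hyK
    have h0 : χ ((extChartAt (𝓡 n) c).symm y) = 0 :=
      image_eq_zero_of_notMem_tsupport fun h => hyK ⟨_, h, (extChartAt (𝓡 n) c).right_inv hy⟩
    simp only [h0, mul_zero, zero_smul]

omit [IsManifold (𝓡 n) ∞ M] [T2Space M] [CompactSpace M] [MeasurableSpace M] [BorelSpace M] in
theorem dirDeriv_eq_zero_of_notMem_tsupport {χ : M → ℝ} {x : M} (hx : x ∉ tsupport χ)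
    (v : TangentSpace (𝓡 n) x) : dirDeriv χ x v = 0 := by
  have h : χ =ᶠ[𝓝 x] fun _ => 0 := notMem_tsupport_iff_eventuallyEq.1 hx
  rw [dirDeriv, mvfderiv, h.mfderiv_eq, mfderiv_const]
  rfl

/-- The integrand is div(χξ) and vanishes off the support of χ, so the global measure may be
replaced by that of the chart. -/
theorem integral_localized_divergence (g : Metric n M) (hθ : IsSmoothOneForm θ) {χ : M → ℝ}
    (hχ : ContMDiff (𝓡 n) 𝓘(ℝ, ℝ) ∞ χ) (c : M) (hc : tsupport χ ⊆ (extChartAt (𝓡 n) c).source) :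
    ∫ x, (χ x * traceAt g.tensor x (deltaStar g.tensor θ x) +
      dirDeriv χ x (sharp g.tensor θ x)) ∂(volumeMeasure g.tensor) = 0 := by
  rw [← integral_chartVolume_eq_zero g hθ hχ c hc, ← volumeMeasure_restrict_source g c,
    setIntegral_eq_integral_of_forall_compl_eq_zero]
  intro x hx
  have hx' : x ∉ tsupport χ := fun h => hx (hc h)
  rw [image_eq_zero_of_notMem_tsupport hx', dirDeriv_eq_zero_of_notMem_tsupport hx']
  ring

-- The sum of the partition functions is the constant 1.
omit [MeasurableSpace M] [BorelSpace M] in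
theorem sum_dirDeriv_chartPartition (x : M) (v : TangentSpace (𝓡 n) x) :
    ∑ c ∈ partitionFinset n M, dirDeriv (chartPartition n M c) x v = 0 := by
  have main : ∀ (c : M), ∀ y ∈ (extChartAt (𝓡 n) c).target,
      ∀ v : TangentSpace (𝓡 n) ((extChartAt (𝓡 n) c).symm y), ∑ c' ∈ partitionFinset n M,
        dirDeriv (chartPartition n M c') ((extChartAt (𝓡 n) c).symm y) v = 0 := by
    intro c y hy v
    obtain ⟨a, rfl⟩ := chartFrame_surjective hy v
    have hd : ∀ c' : M, DifferentiableAt ℝ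
        (fun z => chartPartition n M c' ((extChartAt (𝓡 n) c).symm z)) y := fun c' =>
      ((contDiffOn_comp_symm (chartPartition n M c').contMDiff c).contDiffAt
        (target_mem_nhds hy)).differentiableAt (by simp)
    rw [Finset.sum_congr rfl fun c' _ => dirDeriv_chartFrame hy (hd c') a,
      ← sum_apply, ← fderiv_fun_sum fun c' _ => hd c']
    simp [sum_chartPartition]
  obtain ⟨y, hy, hx⟩ := exists_chart_eq (n := n) x
  have h := main x y hy
  rw [hx] at h
  exact h v

/-- The divergence of a smooth vector field on a compact manifold has integral zero. -/
theorem integral_traceAt_deltaStar (g : Metric n M) (hθ : IsSmoothOneForm θ) :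
    ∫ x, traceAt g.tensor x (deltaStar g.tensor θ x) ∂(volumeMeasure g.tensor) = 0 := by
  have := isFiniteMeasure_volumeMeasure g
  -- This is div ξ = ∑ div(χ_c ξ): the terms dχ_c(ξ) add up to zero.
  have hs : ∀ x, traceAt g.tensor x (deltaStar g.tensor θ x) = ∑ c ∈ partitionFinset n M,
      (chartPartition n M c x * traceAt g.tensor x (deltaStar g.tensor θ x) +
        dirDeriv (chartPartition n M c) x (sharp g.tensor θ x)) := by
    intro x
    rw [Finset.sum_add_distrib, sum_dirDeriv_chartPartition, ← Finset.sum_mul,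
      sum_chartPartition, one_mul, add_zero]
  rw [integral_congr_ae (ae_of_all _ hs), integral_finsetSum]
  · exact Finset.sum_eq_zero fun c _ => integral_localized_divergence g hθ
      (chartPartition n M c).contMDiff c (tsupport_chartPartition_subset c)
  · intro c _
    have hcont : Continuous fun x => chartPartition n M c x *
        traceAt g.tensor x (deltaStar g.tensor θ x) +
        dirDeriv (chartPartition n M c) x (sharp g.tensor θ x) :=
      ((chartPartition n M c).contMDiff.continuous.mul (continuous_traceAt_deltaStar g hθ)).add
        (continuous_dirDeriv_sharp g hθ (chartPartition n M c).contMDiff)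
    exact hcont.integrable_of_hasCompactSupport (HasCompactSupport.of_compactSpace _)

end RiemGeom

/-! ### Energy of the identity and total scalar curvature -/

namespace RiemGeom

variable {n : ℕ} {M : Type*} [TopologicalSpace M] [ChartedSpace (EuclideanSpace ℝ (Fin n)) M]

theorem energyDensity_id (g h : Tensor2 n M) (x : M) :
    energyDensity g h (id : M → M) x = traceAt g x (h x) := by
  have hp : pullback (id : M → M) h x = h x := by
    funext v w
    rw [pullback, mfderiv_id]
    rfl
  rw [energyDensity, hp]

variable [IsManifold (𝓡 n) ∞ M] [T2Space M] [CompactSpace M] [MeasurableSpace M] [BorelSpace M]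
  {g : Metric n M} {θ : OneForm n M} {lam : M → ℝ} {φ : BilinForm n M}

/-- The total scalar curvature in terms of a York decomposition. -/
theorem IsYork.totalScalarCurvature_eq (h : IsYork g θ lam φ) {k : ℝ} (hk : ∀ x, lam x = k) :
    totalScalarCurvature g.tensor = n * k * vol g.tensor := by
  have := isFiniteMeasure_volumeMeasure g
  have hs : ∀ x, scalarCurvature g.tensor x =
      traceAt g.tensor x (deltaStar g.tensor θ x) + n * k := fun x => by
    rw [h.scalarCurvature_eq, hk]
  have hi : Integrable (fun x => traceAt g.tensor x (deltaStar g.tensor θ x))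
      (volumeMeasure g.tensor) :=
    (continuous_traceAt_deltaStar g h.smooth_form).integrable_of_hasCompactSupport
      (HasCompactSupport.of_compactSpace _)
  rw [totalScalarCurvature, integral_congr_ae (ae_of_all _ hs),
    integral_add hi (integrable_const _), integral_traceAt_deltaStar g h.smooth_form,
    integral_const, vol, smul_eq_mul]
  ring

end RiemGeom

theorem corollary3 {n : ℕ} (hn : 3 ≤ n)
    {M : Type*} [TopologicalSpace M] [ChartedSpace (EuclideanSpace ℝ (Fin n)) M]
    [IsManifold (𝓡 n) ∞ M] [T2Space M] [CompactSpace M] [ConnectedSpace M]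
    [MeasurableSpace M] [BorelSpace M]
    (g : RiemGeom.Metric n M)
    (hRic : ∀ (x : M) (v : TangentSpace (𝓡 n) x), v ≠ 0 → 0 < RiemGeom.ricci g.tensor x v v)
    (θ : RiemGeom.OneForm n M) (hθ : RiemGeom.IsSmoothOneForm θ)
    (lam : M → ℝ) (hlam : ContMDiff (𝓡 n) 𝓘(ℝ, ℝ) ∞ lam)
    (φ : RiemGeom.BilinForm n M) (hφ : RiemGeom.IsTT g.tensor φ)
    (hYork : ∀ (x : M) (v w : TangentSpace (𝓡 n) x),
      RiemGeom.ricci g.tensor x v w =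
        (RiemGeom.deltaStar g.tensor θ x v w + lam x * g.tensor x v w) + φ x v w) :
    RiemGeom.IsHarmonicId g.tensor (RiemGeom.ricci g.tensor) ∧
    (RiemGeom.IsInfinitesimalHarmonic g.tensor (RiemGeom.sharp g.tensor θ) →
      ∃ c : ℝ, (∀ x, lam x = c) ∧
        ∫ x, RiemGeom.energyDensity g.tensor (RiemGeom.ricci g.tensor) (id : M → M) x
            ∂(RiemGeom.volumeMeasure g.tensor) = RiemGeom.totalScalarCurvature g.tensor ∧
        RiemGeom.energy g.tensor (RiemGeom.ricci g.tensor) (id : M → M) =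
          (1 / 2) * RiemGeom.totalScalarCurvature g.tensor ∧
        RiemGeom.totalScalarCurvature g.tensor = n * c * RiemGeom.vol g.tensor) := by
  have h : RiemGeom.IsYork g θ lam φ := ⟨hθ, hlam, hφ, hYork⟩
  -- The energy density of the identity into (M, Ric) is tr_g Ric, which is s by definition;
  -- harmonicity of ξ plays no role here.
  have he : ∫ x, RiemGeom.energyDensity g.tensor (RiemGeom.ricci g.tensor) (id : M → M) x
      ∂(RiemGeom.volumeMeasure g.tensor) = RiemGeom.totalScalarCurvature g.tensor := by
    simp only [RiemGeom.energyDensity_id]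
    rfl
  refine ⟨RiemGeom.isHarmonicId_ricci g hRic h.ricci_symm, fun hξ => ?_⟩
  obtain ⟨k, hk⟩ := h.exists_eq_const hn hξ
  exact ⟨k, hk, he, by rw [RiemGeom.energy, he], h.totalScalarCurvature_eq hk⟩
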